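/- **Average purity and fidelity-kernel concentration.** Let $\mathcal N$ be a single-qubit quantum channel with normal form parameters $\mathbf t,\mathbf D\in\mathbb R^3$: there are single-qubit unitaries $U,V$ with $\mathcal N(\cdot)=U\,\mathcal N'(V^\dagger(\cdot)V)\,U^\dagger$, where $\mathcal N'$ is linear, $\mathcal N'(I)=I+t_XX+t_YY+t_ZZ$ and $\mathcal N'(Q)=D_Q Q$ for $Q\in\{X,Y,Z\}$. Consider the random $n$-qubit circuit of depth $L\ge 1$ $$\Phi=\mathcal V^{\mathrm{single}}\circ\mathcal N^{\otimes n}\circ\mathcal U_L\circ\cdots\circ\mathcal N^{\otimes n}\circ\mathcal U_1 ,$$ where all gates are independent, $\mathcal V^{\mathrm{single}}$ is conjugation by $\bigotimes_{i=1}^n u_i$ with each $u_i$ drawn from a 2-design on $\mathrm U(2)$, and each $\mathcal U_l$ is conjugation by a product of two-qubit gates, each drawn from a 2-design on $\mathrm U(4)$, with an arbitrary (possibly random, independently for each layer) layout in which every qubit is acted on by at least one gate. For a state $\sigma$ of $n$ qubits and $S\subseteq[n]$ let $\sigma_S=\mathrm{Tr}_{[n]\setminus S}\,\sigma$. All norms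 are Euclidean. 1. For every $n$, every $L\ge1$ and every $n$-qubit state $\rho$, $$\Big(\frac{1+\|\mathbf t\|^2}{2}\Big)^n\le \mathbb E\,\mathrm{Tr}[\Phi(\rho)^2]\le\Big(\frac{1+\|\mathbf t\|^2+\|\mathbf D\|^2}{2}\Big)^n ,$$ and for every $k$ and every $S\subseteq[n]$ with $|S|=k$, $$\Big(\frac{1+\|\mathbf t\|^2}{2}\Big)^{k}\le \mathbb E\,\mathrm{Tr}[(\Phi(\rho)_S)^2]\le\Big(\frac{1+\|\mathbf t\|^2+\|\mathbf D\|^2}{2}\Big)^{k}.$$ 2. Let $\mathcal D$ be a probability distribution on a data space $\mathcal X$, and let each $x\in\mathcal X$ determine (measurably) the gates of a circuit $\Phi_x$ of the above form, such that for $x\sim\mathcal D$ the gates have a joint law as above. Let $\rho_0$ be an initial state and $\rho(x)=\Phi_x(\rho_0)$. Then, for $x,x'\sim\mathcal D$ independent, the average fidelity kernel satisfies $$\mathbb E_{x,x'}\,\mathrm{Tr}[\rho(x)\rho(x')]\le\Big(\frac{1+\|\mathbf t\|^2+\|\mathbf D\|^2}{2}\Big)^n .$$ 3. If $\|\mathbf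 t\|^2+\|\mathbf D\|^2<1$, this is exponentially small in $n$: there is $c>0$, independent of $n$, $L$, the circuit distribution, the data and the initial state, such that $\mathbb E_{x,x'}\,\mathrm{Tr}[\rho(x)\rho(x')]\le e^{-cn}$ for all $n$ and all $L\ge1$. -/

import Mathlib

open MeasureTheory Matrix
open scoped Kronecker ComplexOrder

universe u

noncomputable section

namespace NoisyCircuit

/-! ## Haar measure and unitary 2-designs -/

section Haar

variable {m : Type*} [Fintype m] [DecidableEq m]

/-- The unitary group carries its Borel sigma-algebra. -/
instance unitaryMeasurableSpace : MeasurableSpace (unitaryGroup m ℂ) := borel _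

instance unitaryBorelSpace : BorelSpace (unitaryGroup m ℂ) := ⟨rfl⟩

theorem isCompact_unitaryGroup : IsCompact (unitaryGroup m ℂ : Set (Matrix m m ℂ)) := by
  have hK : IsCompact {A : Matrix m m ℂ | ∀ i j, A i j ∈ Metric.closedBall (0 : ℂ) 1} := by
    have h := isCompact_univ_pi (X := fun _ : m => m → ℂ)
      (s := fun _ => Set.univ.pi fun _ : m => Metric.closedBall (0 : ℂ) 1)
      fun _ => isCompact_univ_pi fun _ => isCompact_closedBall (0 : ℂ) 1
    have e : {A : Matrix m m ℂ | ∀ i j, A i j ∈ Metric.closedBall (0 : ℂ) 1}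
        = Set.univ.pi fun _ : m => Set.univ.pi fun _ : m => Metric.closedBall (0 : ℂ) 1 := by
      ext A
      exact ⟨fun h i _ j _ => h i j, fun h i j => h i trivial j trivial⟩
    rw [e]
    exact h
  refine hK.of_isClosed_subset ?_ ?_
  · have e : (unitaryGroup m ℂ : Set (Matrix m m ℂ)) = {A | A * star A = 1} := by
      ext A
      exact mem_unitaryGroup_iff
    rw [e]
    exact isClosed_eq (continuous_id.mul continuous_star) continuous_const
  · intro A hA i j
    simpa using entry_norm_bound_of_unitary hA i j

instance unitaryCompactSpace : CompactSpace (unitaryGroup m ℂ) :=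
  isCompact_iff_compactSpace.mp isCompact_unitaryGroup

variable (m) in
/-- The Haar probability measure on the unitary group (total mass one). -/
def haarUnitary : Measure (unitaryGroup m ℂ) := Measure.haarMeasure ⊤

/-- `U^{⊗2} O (U^{⊗2})†`. -/
def twirlTwo (U : unitaryGroup m ℂ) (O : Matrix (m × m) (m × m) ℂ) : Matrix (m × m) (m × m) ℂ :=
  (U.1 ⊗ₖ U.1) * O * (U.1 ⊗ₖ U.1)ᴴ

/-- A unitary 2-design: a probability measure on the unitary group with
`E_ν [U^{⊗2} O U^{†⊗2}] = E_Haar [U^{⊗2} O U^{†⊗2}]` for all `O` (expectations taken entrywise). -/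
def IsTwoDesign (ν : Measure (unitaryGroup m ℂ)) : Prop :=
  IsProbabilityMeasure ν ∧ ∀ (O : Matrix (m × m) (m × m) ℂ) (a b : m × m),
    ∫ U, twirlTwo U O a b ∂ν = ∫ U, twirlTwo U O a b ∂(haarUnitary m)

end Haar

/-! ## Qubits, states and channels -/

/-- Linear operators on `(ℂ²)^{⊗ n}`, in the computational basis. -/
abbrev Op (n : ℕ) : Type := Matrix (Fin n → Fin 2) (Fin n → Fin 2) ℂ

/-- The group of `n`-qubit unitaries. -/
abbrev QU (n : ℕ) : Type := unitaryGroup (Fin n → Fin 2) ℂ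

/-- Density matrices (quantum states). -/
def IsState {n : ℕ} (ρ : Op n) : Prop := ρ.PosSemidef ∧ ρ.trace = 1

/-- Single-qubit operators. -/
abbrev Op1 : Type := Matrix (Fin 2) (Fin 2) ℂ

/-- `(N ⊗ id_D)(σ)` for an operator `σ` on `ℂ² ⊗ ℂ^D`. -/
def ampliation (N : Op1 →ₗ[ℂ] Op1) {d : ℕ} (σ : Matrix (Fin 2 × Fin d) (Fin 2 × Fin d) ℂ) :
    Matrix (Fin 2 × Fin d) (Fin 2 × Fin d) ℂ :=
  fun p q => N (fun a b => σ (a, p.2) (b, q.2)) p.1 q.1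

/-- Single-qubit quantum channel: linear, completely positive and trace preserving. -/
def IsChannel (N : Op1 →ₗ[ℂ] Op1) : Prop :=
  (∀ (d : ℕ) (σ : Matrix (Fin 2 × Fin d) (Fin 2 × Fin d) ℂ),
    σ.PosSemidef → (ampliation N σ).PosSemidef) ∧
  ∀ A, (N A).trace = A.trace

/-- The Pauli matrices `X, Y, Z`. -/
def pauli : Fin 3 → Op1 :=
  ![!![0, 1; 1, 0], !![0, -Complex.I; Complex.I, 0], !![1, 0; 0, -1]]

/-- `t, D ∈ ℝ³` are normal form parameters of `N`: up to unitary rotations `U, V`, i.e.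
`N = U N'(V† · V) U†`, the map `N'` has Pauli transfer matrix `[[1, 0], [t, diag D]]`, that is
`N'(I) = I + t · σ` and `N'(σ_q) = D_q σ_q`. -/
def HasNormalForm (N : Op1 →ₗ[ℂ] Op1) (t D : EuclideanSpace ℝ (Fin 3)) : Prop :=
  ∃ (U V : unitaryGroup (Fin 2) ℂ) (N' : Op1 →ₗ[ℂ] Op1),
    (∀ A, N A = U.1 * N' (V.1ᴴ * A * V.1) * U.1ᴴ) ∧
    N' 1 = 1 + ∑ q, (t q : ℂ) • pauli q ∧
    ∀ q, N' (pauli q) = (D q : ℂ) • pauli q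

/-- `N^{⊗ n}`, the linear map sending `|a⟩⟨b| = ⨂ᵢ |aᵢ⟩⟨bᵢ|` to `⨂ᵢ N(|aᵢ⟩⟨bᵢ|)`. -/
def tensorChannel (N : Op1 →ₗ[ℂ] Op1) {n : ℕ} (A : Op n) : Op n :=
  fun x y => ∑ a, ∑ b, A a b * ∏ i, N (Matrix.single (a i) (b i) 1) (x i) (y i)

/-- `⨂ᵢ uᵢ`. -/
def tensorUnitary {n : ℕ} (v : Fin n → unitaryGroup (Fin 2) ℂ) : Op n :=
  fun x y => ∏ i, (v i).1 (x i) (y i)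

/-- The reduced state `Tr_{[n] ∖ S} A` on the qubits in `S`. -/
def reduced {n : ℕ} (S : Finset (Fin n)) (A : Op n) : Matrix (S → Fin 2) (S → Fin 2) ℂ :=
  fun x y => ∑ z : {k // k ∉ S} → Fin 2,
    A (fun k => if h : k ∈ S then x ⟨k, h⟩ else z ⟨k, h⟩)
      (fun k => if h : k ∈ S then y ⟨k, h⟩ else z ⟨k, h⟩)

/-! ## Layers of two-qubit gates -/

/-- A two-qubit operator `G` acting on the ordered pair of distinct qubits `(e 0, e 1)`, and as the
identity on all other qubits. -/
def gateOp {n : ℕ} (e : Fin 2 ↪ Fin n) (G : Op 2) : Op n :=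
  fun x y => G (x ∘ e) (y ∘ e) * if ∀ k, k ∉ Set.range e → x k = y k then 1 else 0

/-- Splitting the basis index into the two qubits of the gate and the remaining ones. -/
def splitEquiv {n : ℕ} (e : Fin 2 ↪ Fin n) :
    (Fin n → Fin 2) ≃ (Fin 2 → Fin 2) × ({k // k ∉ Set.range e} → Fin 2) where
  toFun x := (x ∘ e, fun k => x k)
  invFun p := fun k =>
    open Classical in
    if h : k ∈ Set.range e then p.1 ((Equiv.ofInjective e e.injective).symm ⟨k, h⟩) else p.2 ⟨k, h⟩
  left_inv x := by
    funext k
    by_cases h : k ∈ Set.range e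
    · obtain ⟨i, rfl⟩ := h
      simp
    · simp only [h, dif_neg, not_false_eq_true]
  right_inv p := by
    refine Prod.ext ?_ ?_
    · funext i
      have h : e i ∈ Set.range e := ⟨i, rfl⟩
      have h2 : (Equiv.ofInjective e e.injective).symm ⟨e i, h⟩ = i := by
        rw [Equiv.symm_apply_eq]
        rfl
      simp only [Function.comp_apply, dif_pos h, h2]
    · funext k
      simp only [k.2, dif_neg, not_false_eq_true]

theorem gateOp_eq {n : ℕ} (e : Fin 2 ↪ Fin n) (G : Op 2) :
    gateOp e G = (G ⊗ₖ (1 : Matrix ({k // k ∉ Set.range e} → Fin 2) _ ℂ)).submatrix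
      (splitEquiv e) (splitEquiv e) := by
  ext x y
  simp [gateOp, splitEquiv, kroneckerMap_apply, Matrix.one_apply, funext_iff]

theorem gateOp_mem {n : ℕ} (e : Fin 2 ↪ Fin n) (G : QU 2) :
    gateOp e G.1 ∈ unitaryGroup (Fin n → Fin 2) ℂ := by
  have h := kronecker_mem_unitary G.2
    (one_mem (unitary (Matrix ({k // k ∉ Set.range e} → Fin 2) _ ℂ)))
  rw [mem_unitaryGroup_iff, star_eq_conjTranspose] at *
  rw [gateOp_eq, conjTranspose_submatrix, submatrix_mul_equiv, h, submatrix_one_equiv]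

/-- A two-qubit gate acting on an ordered pair of distinct qubits, as an `n`-qubit unitary. -/
def gateOn {n : ℕ} (e : Fin 2 ↪ Fin n) (G : QU 2) : QU n := ⟨gateOp e G.1, gateOp_mem e G⟩

/-- A layout of two-qubit gates: the list of the ordered pairs of distinct qubits acted on. -/
abbrev Layout (n : ℕ) : Type := List (Fin 2 ↪ Fin n)

/-- Each qubit is acted on by at least one of the gates. -/
def Layout.Covers {n : ℕ} (ℓ : Layout n) : Prop := ∀ k, ∃ e ∈ ℓ, k ∈ Set.range e

/-- The unitary of a circuit of two-qubit gates with the given layout. -/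
def layerUnitary {n : ℕ} (ℓ : Layout n) (G : Fin ℓ.length → QU 2) : QU n :=
  (List.ofFn fun i => gateOn (ℓ.get i) (G i)).prod

/-- `2`-local `2`-design layer distribution: a (possibly random) layout of two-qubit gates that
covers all qubits is drawn from `p`, and then the gates are drawn independently, each from a
`2`-design on `U(4)`; `ν` is the law of the resulting `n`-qubit unitary. -/
def IsLocalDesignLayer {n : ℕ} (ν : Measure (QU n)) : Prop :=
  ∃ (p : PMF (Layout n)) (γ : (ℓ : Layout n) → Fin ℓ.length → Measure (QU 2)),
    (∀ ℓ ∈ p.support, ℓ.Covers) ∧ (∀ ℓ i, IsTwoDesign (γ ℓ i)) ∧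
    ν = Measure.sum fun ℓ => p ℓ • (Measure.pi (γ ℓ)).map (layerUnitary ℓ)

/-! ## Noisy circuits -/

/-- The random data of a depth-`L` circuit: the layers `U_1, …, U_L` (indexed from `0`) and the
final single-qubit gates `u_1, …, u_n`. -/
abbrev Gates (n L : ℕ) : Type := (Fin L → QU n) × (Fin n → unitaryGroup (Fin 2) ℂ)

/-- `N^{⊗n} ∘ U_L ∘ ⋯ ∘ N^{⊗n} ∘ U_1` applied to `ρ`. -/
def noisyLayers (N : Op1 →ₗ[ℂ] Op1) {n : ℕ} : (L : ℕ) → (Fin L → QU n) → Op n → Op n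
  | 0, _, ρ => ρ
  | L + 1, U, ρ => tensorChannel N
      ((U (Fin.last L)).1 * noisyLayers N L (fun l => U l.castSucc) ρ * (U (Fin.last L)).1ᴴ)

/-- The noisy circuit `Φ = V^{single} ∘ N^{⊗n} ∘ U_L ∘ ⋯ ∘ N^{⊗n} ∘ U_1` applied to `ρ`. -/
def circuit (N : Op1 →ₗ[ℂ] Op1) {n L : ℕ} (g : Gates n L) (ρ : Op n) : Op n :=
  tensorUnitary g.2 * noisyLayers N L g.1 ρ * (tensorUnitary g.2)ᴴ

/-- `P` is the law of a random circuit of the model: independent layers, each with a `2`-local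
`2`-design layer distribution, and independent final single-qubit gates, each from a `2`-design. -/
def IsCircuitLaw {n L : ℕ} (P : Measure (Gates n L)) : Prop :=
  ∃ (ν : Fin L → Measure (QU n)) (μ : Fin n → Measure (unitaryGroup (Fin 2) ℂ)),
    (∀ l, IsLocalDesignLayer (ν l)) ∧ (∀ i, IsTwoDesign (μ i)) ∧
    P = (Measure.pi ν).prod (Measure.pi μ)

/-- The purity `Tr[A²]` (a real number when `A` is Hermitian). -/
def purity {d : Type*} [Fintype d] (A : Matrix d d ℂ) : ℝ := (A * A).trace.re

/-- The fidelity quantum kernel `κ(x, x') = Tr[ρ(x) ρ(x')]`, where `ρ(x) = Φ_x(ρ₀)` and the data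
point `x` selects the gates `G x` of the circuit `Φ_x`. -/
def fidelityKernel (N : Op1 →ₗ[ℂ] Op1) {n L : ℕ} {X : Type*} (G : X → Gates n L) (ρ₀ : Op n)
    (x x' : X) : ℝ :=
  (circuit N (G x) ρ₀ * circuit N (G x') ρ₀).trace.re

end NoisyCircuit

end

/-! Only the last layer of gates matters. Fix the earlier layers and the final single-qubit gates;
the input σ of the last layer is then a fixed state. Expand `UσU†` in Pauli strings rotated by the
unitary V of the normal form. The noise acts sitewise on such strings, and final product unitaries
do not affect the purity of any reduced state, so this purity is 4^{-n} times a double sum over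
strings P, Q of ⟨P⟩⟨Q⟩ times a product of single-site traces (`trace_reduced_mul_self`).

The average over U leaves only P = Q. Suppose P ≠ Q. If exactly one of them is the identity at some
site k, a Pauli at k that anticommutes with the other one flips the sign of ⟨P⟩⟨Q⟩. The layer
contains a gate on k, the integrand has degree (2,2) in the entries of that gate, so the 2-design
may be replaced by Haar measure, whose invariance makes the average equal to its own negative
(`IsLocalDesignLayer.integral_pauliString_eq_zero`). Otherwise P and Q carry different nontrivial
Paulis at some site, and the single-site trace there is zero because D is diagonal
(`HasNormalForm.exists_siteKernel`).

What remains is a sum over P of nonnegative weights times the second moments E⟨P⟩², which lie in [0,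
1] and equal 1 for the identity string. Keeping only the identity string gives the lower bound;
replacing every moment by 1 lets the sum factor over sites and gives the upper bound
(`IsLocalDesignLayer.integral_purity_bounds`). Both are uniform in what was fixed, so they survive
averaging over the rest of the circuit.

For the kernel, Tr[AB] ≤ (Tr A² + Tr B²)/2 for Hermitian A, B, so its mean is at most the mean
purity. -/

noncomputable section

namespace NoisyCircuit

/-! ## Product operators -/

section TensorOp

variable {ι : Type*} [Fintype ι]

/-- The product operator `⨂ᵢ Mᵢ`. -/
def tensorOp (M : ι → Op1) : Matrix (ι → Fin 2) (ι → Fin 2) ℂ :=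
  fun x y => ∏ i, M i (x i) (y i)

theorem tensorOp_one : tensorOp (fun _ : ι => (1 : Op1)) = 1 := by
  classical
  ext x y
  simp only [tensorOp, Matrix.one_apply, funext_iff]
  rw [Fintype.prod_ite_zero]
  simp

theorem tensorOp_mul [DecidableEq ι] (M M' : ι → Op1) :
    tensorOp M * tensorOp M' = tensorOp fun i => M i * M' i := by
  ext x y
  simp only [tensorOp, Matrix.mul_apply, Fintype.prod_sum, Finset.prod_mul_distrib]

theorem tensorOp_conjTranspose (M : ι → Op1) : (tensorOp M)ᴴ = tensorOp fun i => (M i)ᴴ := by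
  ext x y
  simp [tensorOp, Matrix.conjTranspose_apply]

theorem trace_tensorOp [DecidableEq ι] (M : ι → Op1) : (tensorOp M).trace = ∏ i, (M i).trace := by
  simp only [tensorOp, Matrix.trace, Matrix.diag, Fintype.prod_sum]

theorem tensorOp_mem [DecidableEq ι] {M : ι → Op1} (h : ∀ i, M i ∈ unitaryGroup (Fin 2) ℂ) :
    tensorOp M ∈ unitaryGroup (ι → Fin 2) ℂ := by
  rw [mem_unitaryGroup_iff, star_eq_conjTranspose, tensorOp_conjTranspose, tensorOp_mul]
  have : (fun i => M i * (M i)ᴴ) = fun _ => 1 :=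
    funext fun i => mem_unitaryGroup_iff.mp (h i)
  rw [this, tensorOp_one]

theorem tensorOp_smul (c : ι → ℂ) (M : ι → Op1) :
    tensorOp (fun i => c i • M i) = (∏ i, c i) • tensorOp M := by
  ext x y
  simp [tensorOp, Finset.prod_mul_distrib]

end TensorOp

theorem tensorUnitary_eq {n : ℕ} (v : Fin n → unitaryGroup (Fin 2) ℂ) :
    tensorUnitary v = tensorOp fun i => (v i).1 := rfl

theorem reduced_tensorOp {n : ℕ} (S : Finset (Fin n)) (M : Fin n → Op1) :
    reduced S (tensorOp M)
      = (∏ k : {k // k ∉ S}, (M k).trace) • tensorOp (fun k : S => M k) := by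
  ext x y
  simp only [reduced, tensorOp, Matrix.smul_apply, smul_eq_mul, Matrix.trace, Matrix.diag,
    Fintype.prod_sum, Finset.sum_mul]
  refine Finset.sum_congr rfl fun z _ => ?_
  rw [← Fintype.prod_subtype_mul_prod_subtype (fun k => k ∈ S), mul_comm]
  congr 1
  · exact Finset.prod_congr rfl fun k _ => by simp [k.2]
  · exact Finset.prod_congr (by ext; simp) fun k _ => by simp [k.2]

/-- The partial trace as a linear map. -/
def reducedLin {n : ℕ} (S : Finset (Fin n)) : Op n →ₗ[ℂ] Matrix (S → Fin 2) (S → Fin 2) ℂ where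
  toFun := reduced S
  map_add' A B := by
    ext x y
    simp [reduced, Finset.sum_add_distrib]
  map_smul' c A := by
    ext x y
    simp [reduced, Finset.mul_sum]

/-- `N^{⊗ n}` as a linear map. -/
def tensorChannelLin (N : Op1 →ₗ[ℂ] Op1) (n : ℕ) : Op n →ₗ[ℂ] Op n where
  toFun := tensorChannel N
  map_add' A B := by
    ext x y
    simp [tensorChannel, add_mul, Finset.sum_add_distrib]
  map_smul' c A := by
    ext x y
    simp [tensorChannel, Finset.mul_sum, mul_assoc]

theorem linearMap_eq_sum_single (N : Op1 →ₗ[ℂ] Op1) (A : Op1) :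
    N A = ∑ a, ∑ b, A a b • N (Matrix.single a b 1) := by
  conv_lhs => rw [matrix_eq_sum_single A]
  simp only [map_sum, ← map_smul, Matrix.smul_single, smul_eq_mul, mul_one]

theorem tensorChannel_tensorOp (N : Op1 →ₗ[ℂ] Op1) {n : ℕ} (M : Fin n → Op1) :
    tensorChannel N (tensorOp M) = tensorOp fun i => N (M i) := by
  ext x y
  simp only [tensorChannel, tensorOp, ← Finset.prod_mul_distrib]
  have h (i : Fin n) : N (M i) (x i) (y i)
      = ∑ a, ∑ b, M i a b * N (Matrix.single a b 1) (x i) (y i) := by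
    rw [linearMap_eq_sum_single N (M i)]
    simp [Matrix.sum_apply]
  simp only [h, Fintype.prod_sum]

/-! ## Rotated Pauli basis -/

/-- The Pauli basis `I, X, Y, Z`. -/
def pauliBasis : Option (Fin 3) → Op1
  | none => 1
  | some q => pauli q

theorem pauli_conjTranspose (q : Fin 3) : (pauli q)ᴴ = pauli q := by
  fin_cases q <;> ext i j <;> fin_cases i <;> fin_cases j <;> simp [pauli]

theorem pauli_mul_self (q : Fin 3) : pauli q * pauli q = 1 := by
  fin_cases q <;> ext i j <;> fin_cases i <;> fin_cases j <;> simp [pauli]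

theorem trace_pauli (q : Fin 3) : (pauli q).trace = 0 := by
  fin_cases q <;> simp [pauli, Matrix.trace_fin_two]

theorem trace_pauli_mul (p q : Fin 3) : (pauli p * pauli q).trace = if p = q then 2 else 0 := by
  fin_cases p <;> fin_cases q <;> simp [pauli, Matrix.trace_fin_two] <;> norm_num

/-- Addition in `Fin 3` is cyclic, so q + 1 always names a Pauli other than q, hence one
anticommuting with it. This is the source of the sign flip in the twirling argument. -/
theorem pauli_anticomm (q : Fin 3) : pauli (q + 1) * pauli q * pauli (q + 1) = -pauli q := by
  fin_cases q <;> ext i j <;> fin_cases i <;> fin_cases j <;> simp [pauli]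

theorem pauli_expansion (A : Op1) :
    A = (2 : ℂ)⁻¹ • ∑ q, (pauliBasis q * A).trace • pauliBasis q := by
  ext i j
  fin_cases i <;> fin_cases j <;>
    simp [Fintype.sum_option, pauliBasis, pauli, Fin.sum_univ_three, Matrix.trace_fin_two,
      Matrix.mul_apply] <;> ring_nf <;> simp <;> ring

section Rot

variable (V : unitaryGroup (Fin 2) ℂ)

theorem unitary_conj_mul : V.1ᴴ * V.1 = 1 := mem_unitaryGroup_iff'.mp V.2

theorem unitary_mul_conj : V.1 * V.1ᴴ = 1 := mem_unitaryGroup_iff.mp V.2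

/-- The rotated Pauli basis `V P V†`. -/
def rotPauli (q : Option (Fin 3)) : Op1 := V.1 * pauliBasis q * V.1ᴴ

theorem rotPauli_none : rotPauli V none = 1 := by
  simp [rotPauli, pauliBasis, unitary_mul_conj]

theorem conj_mul_conj (A B : Op1) :
    V.1 * A * V.1ᴴ * (V.1 * B * V.1ᴴ) = V.1 * (A * B) * V.1ᴴ := by
  calc _ = V.1 * A * (V.1ᴴ * V.1) * B * V.1ᴴ := by noncomm_ring
    _ = _ := by rw [unitary_conj_mul]; noncomm_ring

theorem pauliBasis_mul_self (q : Option (Fin 3)) : pauliBasis q * pauliBasis q = 1 := by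
  cases q <;> simp [pauliBasis, pauli_mul_self]

theorem rotPauli_mul_self (q : Option (Fin 3)) : rotPauli V q * rotPauli V q = 1 := by
  rw [rotPauli, conj_mul_conj, pauliBasis_mul_self, mul_one, unitary_mul_conj]

theorem rotPauli_conjTranspose (q : Option (Fin 3)) : (rotPauli V q)ᴴ = rotPauli V q := by
  have : (pauliBasis q)ᴴ = pauliBasis q := by cases q <;> simp [pauliBasis, pauli_conjTranspose]
  simp [rotPauli, Matrix.conjTranspose_mul, this, mul_assoc]

theorem rotPauli_mem (q : Option (Fin 3)) : rotPauli V q ∈ unitaryGroup (Fin 2) ℂ := by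
  rw [mem_unitaryGroup_iff, star_eq_conjTranspose, rotPauli_conjTranspose, rotPauli_mul_self]

theorem rotPauli_anticomm (q : Fin 3) :
    rotPauli V (some (q + 1)) * rotPauli V (some q) * (rotPauli V (some (q + 1)))ᴴ
      = -rotPauli V (some q) := by
  rw [rotPauli_conjTranspose]
  simp only [rotPauli, conj_mul_conj, pauliBasis, pauli_anticomm]
  simp

theorem rotPauli_expansion (A : Op1) :
    A = (2 : ℂ)⁻¹ • ∑ q, (rotPauli V q * A).trace • rotPauli V q := by
  have h := pauli_expansion (V.1ᴴ * A * V.1)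
  have e : A = V.1 * (V.1ᴴ * A * V.1) * V.1ᴴ := by
    calc A = (V.1 * V.1ᴴ) * A * (V.1 * V.1ᴴ) := by rw [unitary_mul_conj]; simp
      _ = _ := by noncomm_ring
  have ht (q) : (pauliBasis q * (V.1ᴴ * A * V.1)).trace = (rotPauli V q * A).trace := by
    rw [rotPauli, ← mul_assoc, trace_mul_comm]
    simp only [mul_assoc]
  simp only [ht] at h
  conv_lhs => rw [e, h]
  simp only [Matrix.mul_smul, Matrix.smul_mul, Matrix.mul_sum, Matrix.sum_mul]
  rfl

/-- Expanding the matrix unit |d⟩⟨c| in the basis gives the sum of P ⊗ P over the basis as twice the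
swap. In this entrywise form the identity multiplies over qubits, which yields the expansion in
strings. -/
theorem rotPauli_completeness (a b c d : Fin 2) :
    ∑ q, rotPauli V q a b * rotPauli V q c d = if a = d ∧ b = c then 2 else 0 := by
  have h := congrFun (congrFun (rotPauli_expansion V (Matrix.single d c 1)) a) b
  have ht (q) : (rotPauli V q * Matrix.single d c 1).trace = rotPauli V q c d := by
    rw [Matrix.trace_mul_single]
    simp
  simp only [ht, Matrix.smul_apply, Matrix.sum_apply, smul_eq_mul] at h
  rw [Matrix.single_apply] at h
  have h2 : ∑ q, rotPauli V q a b * rotPauli V q c d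
      = 2 * (2⁻¹ * ∑ q, rotPauli V q c d * rotPauli V q a b) := by
    rw [← mul_assoc, mul_inv_cancel₀ two_ne_zero, one_mul]
    exact Finset.sum_congr rfl fun q _ => mul_comm _ _
  rw [h2, ← h]
  simp [eq_comm]

/-- The `n`-qubit rotated Pauli string. -/
def pauliString {n : ℕ} (P : Fin n → Option (Fin 3)) : Op n := tensorOp fun i => rotPauli V (P i)

theorem pauliString_expansion {n : ℕ} (B : Op n) :
    B = ((2 : ℂ) ^ n)⁻¹ • ∑ P, (pauliString V P * B).trace • pauliString V P := by
  have hc (a b c d : Fin n → Fin 2) : ∑ P, pauliString V P a b * pauliString V P c d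
      = if a = d ∧ b = c then (2 : ℂ) ^ n else 0 := by
    simp only [pauliString, tensorOp, ← Finset.prod_mul_distrib]
    rw [← Fintype.prod_sum (fun i q => rotPauli V q (a i) (b i) * rotPauli V q (c i) (d i))]
    simp only [rotPauli_completeness]
    rw [Fintype.prod_ite_zero]
    simp [funext_iff, forall_and]
  ext x y
  simp only [Matrix.smul_apply, Matrix.sum_apply, smul_eq_mul, Matrix.trace, Matrix.diag,
    Matrix.mul_apply, Finset.sum_mul]
  rw [Finset.sum_comm]
  have e (c : Fin n → Fin 2) : ∑ P, ∑ d, pauliString V P c d * B d c * pauliString V P x y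
      = ∑ d, B d c * if x = d ∧ y = c then (2 : ℂ) ^ n else 0 := by
    rw [Finset.sum_comm]
    refine Finset.sum_congr rfl fun d _ => ?_
    rw [← hc, Finset.mul_sum]
    exact Finset.sum_congr rfl fun P _ => by ring
  simp only [e, ite_and, mul_ite, mul_zero, Finset.sum_ite_eq, Finset.mem_univ, if_true]
  field_simp

theorem pauliString_none {n : ℕ} : pauliString V (fun _ : Fin n => none) = 1 := by
  simp [pauliString, rotPauli_none, tensorOp_one]

theorem pauliString_mul_self {n : ℕ} (P : Fin n → Option (Fin 3)) :
    pauliString V P * pauliString V P = 1 := by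
  simp [pauliString, tensorOp_mul, rotPauli_mul_self, tensorOp_one]

theorem pauliString_conjTranspose {n : ℕ} (P : Fin n → Option (Fin 3)) :
    (pauliString V P)ᴴ = pauliString V P := by
  simp [pauliString, tensorOp_conjTranspose, rotPauli_conjTranspose]

end Rot

/-- An involution has expectation of modulus at most one in every state. -/
theorem expectation_involution {d : Type*} [Fintype d] [DecidableEq d] {T B : Matrix d d ℂ}
    (hT : Tᴴ = T) (hTT : T * T = 1) (hB : B.PosSemidef) (htr : B.trace = 1) :
    ∃ r : ℝ, (T * B).trace = r ∧ r ^ 2 ≤ 1 := by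
  -- Used at s = ±1: (1 + sT)/2 is then an orthogonal projection, so its expectation is nonnegative.
  -- The two signs bound Tr[TB] by 1 in modulus; the complex order also makes it real.
  have key (s : ℂ) (hs : s * s = 1) (hs' : star s = s) : 0 ≤ 1 + s * (T * B).trace := by
    have h := (hB.mul_mul_conjTranspose_same (1 + s • T)).trace_nonneg
    have e : (((1 + s • T) * B * (1 + s • T)ᴴ)).trace = 2 * (1 + s * (T * B).trace) := by
      rw [Matrix.conjTranspose_add, Matrix.conjTranspose_smul, hT, hs', conjTranspose_one,
        mul_assoc, trace_mul_comm, mul_assoc]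
      have : (1 + s • T) * (1 + s • T) = (2 : ℂ) • (1 + s • T) := by
        simp only [add_mul, mul_add, one_mul, mul_one, Matrix.smul_mul, Matrix.mul_smul, smul_smul,
          hTT, hs]
        module
      rw [this, Matrix.mul_smul, trace_smul, mul_add, trace_add, mul_one, htr, Matrix.mul_smul,
        trace_smul, trace_mul_comm]
      simp
    rw [e] at h
    have h2 : (0 : ℂ) ≤ 2⁻¹ := by
      rw [Complex.nonneg_iff]; norm_num
    have := mul_nonneg h2 h
    rwa [← mul_assoc, inv_mul_cancel₀ two_ne_zero, one_mul] at this
  have h1 := key 1 (by simp) (by simp)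
  have h2 := key (-1) (by simp) (by simp)
  rw [Complex.nonneg_iff] at h1 h2
  simp at h1 h2
  refine ⟨(T * B).trace.re, ?_, ?_⟩
  · apply Complex.ext <;> simp [← h1.2]
  · nlinarith [h1.1, h2.1]

/-! ## Channels preserve states -/

/-- The Choi matrix is positive semidefinite by complete positivity, hence a sum of rank-one terms,
and each vector reshapes into a Kraus operator. Kraus operators are what transfers positivity from
one qubit to N^{⊗n}. -/
theorem IsChannel.exists_kraus {N : Op1 →ₗ[ℂ] Op1} (hN : IsChannel N) :
    ∃ (m : ℕ) (K : Fin m → Op1), ∀ a b x y,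
      N (Matrix.single a b 1) x y = ∑ k, K k x a * star (K k y b) := by
  -- The unnormalised maximally entangled state, whose image under N ⊗ id is the Choi matrix.
  have hω : (Matrix.of fun p q : Fin 2 × Fin 2 =>
      (if p.1 = p.2 then (1 : ℂ) else 0) * (if q.1 = q.2 then 1 else 0)).PosSemidef := by
    have h := posSemidef_vecMulVec_self_star (fun p : Fin 2 × Fin 2 => if p.1 = p.2 then (1 : ℂ) else 0)
    convert h using 1
    ext p q
    by_cases hp : p.1 = p.2 <;> by_cases hq : q.1 = q.2 <;> simp [vecMulVec_apply, hp, hq]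
  have h := hN.1 2 _ hω
  obtain ⟨m, v, hv⟩ := posSemidef_iff_eq_sum_vecMulVec.mp h
  refine ⟨m, fun k => Matrix.of fun x a => v k (x, a), fun a b x y => ?_⟩
  have e := congrFun (congrFun hv (x, a)) (y, b)
  simp only [Matrix.sum_apply, vecMulVec_apply, Pi.star_apply] at e
  simp only [of_apply]
  rw [← e, ampliation]
  refine congrFun (congrFun (congrArg N ?_) x) y
  ext i j
  simp only [Matrix.single_apply, of_apply, ite_and, mul_ite, mul_one, mul_zero, eq_comm]
  split_ifs <;> rfl

theorem tensorChannel_posSemidef {N : Op1 →ₗ[ℂ] Op1} (hN : IsChannel N) {n : ℕ} {A : Op n}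
    (hA : A.PosSemidef) : (tensorChannel N A).PosSemidef := by
  obtain ⟨m, K, hK⟩ := hN.exists_kraus
  -- The Kraus operators of N^{⊗n} are the products of single-qubit ones, one choice κ i per qubit.
  have e : tensorChannel N A = ∑ κ : Fin n → Fin m,
      tensorOp (fun i => K (κ i)) * A * (tensorOp fun i => K (κ i))ᴴ := by
    ext x y
    simp only [tensorChannel, hK, Fintype.prod_sum, Matrix.sum_apply, Matrix.mul_apply, tensorOp,
      Matrix.conjTranspose_apply, star_prod, Finset.mul_sum, Finset.sum_mul,
      Finset.prod_mul_distrib]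
    rw [Finset.sum_congr rfl fun a _ => Finset.sum_comm, Finset.sum_comm]
    refine Finset.sum_congr rfl fun κ _ => ?_
    rw [Finset.sum_comm]
    exact Finset.sum_congr rfl fun a _ => Finset.sum_congr rfl fun b _ => by ring
  rw [e]
  exact posSemidef_sum _ fun κ _ => hA.mul_mul_conjTranspose_same _

theorem trace_tensorChannel {N : Op1 →ₗ[ℂ] Op1} (hN : IsChannel N) {n : ℕ} (A : Op n) :
    (tensorChannel N A).trace = A.trace := by
  have h (a b : Fin n → Fin 2) : ∑ x : Fin n → Fin 2, ∏ i, N (Matrix.single (a i) (b i) 1) (x i) (x i)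
      = if a = b then 1 else 0 := by
    rw [← Fintype.prod_sum (fun i c => N (Matrix.single (a i) (b i) 1) c c)]
    have h1 (i : Fin n) : ∑ c, N (Matrix.single (a i) (b i) 1) c c = if a i = b i then 1 else 0 := by
      have h2 := hN.2 (Matrix.single (a i) (b i) 1)
      rw [Matrix.trace] at h2
      simp only [Matrix.diag] at h2
      rw [h2]
      split_ifs with h3
      · rw [h3, trace_single_eq_same]
      · rw [trace_single_eq_of_ne _ _ _ h3]
    simp only [h1, Fintype.prod_ite_zero]
    simp [funext_iff]
  simp only [Matrix.trace, Matrix.diag, tensorChannel]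
  rw [Finset.sum_comm]
  refine Finset.sum_congr rfl fun a _ => ?_
  rw [Finset.sum_comm]
  simp only [← Finset.mul_sum, h]
  simp

theorem IsState.tensorChannel {N : Op1 →ₗ[ℂ] Op1} (hN : IsChannel N) {n : ℕ} {A : Op n}
    (hA : IsState A) : IsState (tensorChannel N A) :=
  ⟨tensorChannel_posSemidef hN hA.1, (trace_tensorChannel hN A).trans hA.2⟩

theorem IsState.unitary_conj {n : ℕ} {A : Op n} (hA : IsState A) (U : QU n) :
    IsState (U.1 * A * U.1ᴴ) := by
  refine ⟨hA.1.mul_mul_conjTranspose_same _, ?_⟩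
  rw [trace_mul_comm, ← mul_assoc]
  have : U.1ᴴ * U.1 = 1 := mem_unitaryGroup_iff'.mp U.2
  rw [this, one_mul, hA.2]

theorem IsState.noisyLayers {N : Op1 →ₗ[ℂ] Op1} (hN : IsChannel N) {n : ℕ} {ρ : Op n}
    (hρ : IsState ρ) : ∀ (L : ℕ) (U : Fin L → QU n), IsState (noisyLayers N L U ρ)
  | 0, _ => hρ
  | L + 1, _ => ((hρ.noisyLayers hN L _).unitary_conj _).tensorChannel hN

/-! ## Integration over the unitary group -/

section Integration

variable {m : Type*} [Fintype m] [DecidableEq m]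

instance unitarySecondCountable : SecondCountableTopology (unitaryGroup m ℂ) :=
  haveI : SecondCountableTopology (Matrix m m ℂ) :=
    inferInstanceAs (SecondCountableTopology (m → m → ℂ))
  TopologicalSpace.Subtype.secondCountableTopology _

instance haarUnitary_isProbability : IsProbabilityMeasure (haarUnitary m) :=
  ⟨Measure.haarMeasure_self⟩

instance haarUnitary_isMulLeftInvariant : (haarUnitary m).IsMulLeftInvariant :=
  inferInstanceAs (Measure.haarMeasure _).IsMulLeftInvariant

theorem _root_.Continuous.integrable_of_compactSpace {X E : Type*} [TopologicalSpace X]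
    [CompactSpace X] [MeasurableSpace X] [OpensMeasurableSpace X] [NormedAddCommGroup E]
    {μ : Measure X} [IsFiniteMeasure μ] {f : X → E} (hf : Continuous f) : Integrable f μ :=
  hf.integrable_of_hasCompactSupport (HasCompactSupport.of_compactSpace f)

variable (m) in
/-- Functions on the unitary group of degree `(1, 1)` in the entries and their conjugates. -/
def bilinearFunctions : Submodule ℂ (unitaryGroup m ℂ → ℂ) :=
  Submodule.span ℂ (Set.range fun (p : (m × m) × (m × m)) (U : unitaryGroup m ℂ) =>
    U.1 p.1.1 p.1.2 * star (U.1 p.2.1 p.2.2))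

theorem continuous_entry (a b : m) : Continuous fun U : unitaryGroup m ℂ => U.1 a b :=
  continuous_subtype_val.matrix_elem a b

/-- A monomial of degree (2,2) is an entry of the twirl of a matrix unit, so the 2-design property
covers it, and linearity covers the span. Continuity is carried through the induction to supply
integrability. -/
theorem IsTwoDesign.integral_eq {ν : Measure (unitaryGroup m ℂ)} (hν : IsTwoDesign ν)
    {F : unitaryGroup m ℂ → ℂ} (hF : F ∈ bilinearFunctions m * bilinearFunctions m) :
    ∫ U, F U ∂ν = ∫ U, F U ∂(haarUnitary m) := by
  have := hν.1
  suffices h : Continuous F ∧ ∫ U, F U ∂ν = ∫ U, F U ∂(haarUnitary m) from h.2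
  rw [bilinearFunctions, Submodule.span_mul_span] at hF
  induction hF using Submodule.span_induction with
  | mem f hf =>
    obtain ⟨_, ⟨p, rfl⟩, _, ⟨q, rfl⟩, rfl⟩ := hf
    refine ⟨((continuous_entry _ _).mul (continuous_entry _ _).star).mul
      ((continuous_entry _ _).mul (continuous_entry _ _).star), ?_⟩
    have h := hν.2 (Matrix.single (p.1.2, q.1.2) (p.2.2, q.2.2) 1) (p.1.1, q.1.1) (p.2.1, q.2.1)
    have e (U : unitaryGroup m ℂ) :
        twirlTwo U (Matrix.single (p.1.2, q.1.2) (p.2.2, q.2.2) 1) (p.1.1, q.1.1) (p.2.1, q.2.1)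
          = U.1 p.1.1 p.1.2 * star (U.1 p.2.1 p.2.2)
            * (U.1 q.1.1 q.1.2 * star (U.1 q.2.1 q.2.2)) := by
      rw [twirlTwo, Matrix.mul_apply, Finset.sum_eq_single (p.2.2, q.2.2)]
      · simp [kroneckerMap_apply]
        ring
      · intro b _ hb
        rw [Matrix.mul_single_apply_of_ne _ _ _ _ _ hb, zero_mul]
      · simp
    simpa only [e, Pi.mul_apply] using h
  | zero => exact ⟨continuous_const, by simp⟩
  | add f g _ _ hf hg =>
    refine ⟨hf.1.add hg.1, ?_⟩
    simp only [Pi.add_apply]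
    rw [integral_add hf.1.integrable_of_compactSpace hg.1.integrable_of_compactSpace,
      integral_add hf.1.integrable_of_compactSpace hg.1.integrable_of_compactSpace, hf.2, hg.2]
  | smul c f _ hf =>
    refine ⟨hf.1.const_smul c, ?_⟩
    simp only [Pi.smul_apply]
    rw [integral_smul, integral_smul, hf.2]

end Integration

/-! ## Product operators and gates -/

theorem tensorOp_split {n : ℕ} (e : Fin 2 ↪ Fin n) (M : Fin n → Op1) :
    tensorOp M = (tensorOp (fun i => M (e i)) ⊗ₖ
      tensorOp fun k : {k // k ∉ Set.range e} => M k).submatrix (splitEquiv e) (splitEquiv e) := by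
  classical
  ext x y
  simp only [tensorOp, submatrix_apply, kroneckerMap_apply, splitEquiv, Equiv.coe_fn_mk,
    Function.comp_apply]
  rw [← Fintype.prod_subtype_mul_prod_subtype (fun k => k ∈ Set.range e)]
  congr 1
  refine (Finset.prod_congr (by ext; simp) fun _ _ => rfl).trans
    (Fintype.prod_equiv (Equiv.ofInjective e e.injective)
      (fun i => M (e i) (x (e i)) (y (e i))) (fun k => M k.1 (x k.1) (y k.1)) fun i => rfl).symm

/-- The operator `W` on qubit `k`. -/
def siteOp {n : ℕ} (k : Fin n) (W : Op1) : Op n := tensorOp (Function.update (fun _ => 1) k W)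

theorem siteOp_mem {n : ℕ} (k : Fin n) (W : unitaryGroup (Fin 2) ℂ) :
    siteOp k W.1 ∈ unitaryGroup (Fin n → Fin 2) ℂ := by
  refine tensorOp_mem fun i => ?_
  by_cases h : i = k
  · subst h; simp
  · simp [h, one_mem]

theorem siteOp_range {n : ℕ} (e : Fin 2 ↪ Fin n) (j : Fin 2) (W : Op1) :
    siteOp (e j) W = gateOp e (siteOp j W) := by
  rw [gateOp_eq, siteOp, siteOp, tensorOp_split e]
  congr 2
  · congr 1
    funext i
    simp [Function.update_apply]
  · rw [← tensorOp_one]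
    congr 1
    funext k
    rw [Function.update_of_ne]
    rintro h
    exact k.2 ⟨j, h.symm⟩

theorem siteOp_commute_gateOp {n : ℕ} (e : Fin 2 ↪ Fin n) {k : Fin n} (hk : k ∉ Set.range e)
    (W : Op1) (G : Op 2) : siteOp k W * gateOp e G = gateOp e G * siteOp k W := by
  have h : (fun i => Function.update (fun _ => (1 : Op1)) k W (e i)) = fun _ => 1 := by
    funext i
    rw [Function.update_of_ne]
    exact fun h => hk ⟨i, h⟩
  rw [gateOp_eq, siteOp, tensorOp_split e, h, tensorOp_one, submatrix_mul_equiv,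
    submatrix_mul_equiv, ← mul_kronecker_mul, ← mul_kronecker_mul]
  simp

theorem gateOp_mul {n : ℕ} (e : Fin 2 ↪ Fin n) (G H : Op 2) :
    gateOp e (G * H) = gateOp e G * gateOp e H := by
  rw [gateOp_eq, gateOp_eq, gateOp_eq, submatrix_mul_equiv, ← mul_kronecker_mul, one_mul]

theorem gateOp_conjTranspose {n : ℕ} (e : Fin 2 ↪ Fin n) (G : Op 2) :
    (gateOp e G)ᴴ = gateOp e Gᴴ := by
  rw [gateOp_eq, gateOp_eq, conjTranspose_submatrix, conjTranspose_kronecker, conjTranspose_one]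

/-! ## Pauli twirling by a layer -/

/-- `Tr[O U σ U†]`. -/
def expect {n : ℕ} (O σ U : Op n) : ℂ := (O * (U * σ * Uᴴ)).trace

theorem expect_mul {n : ℕ} (O σ U V : Op n) : expect O σ (U * V) = expect O (V * σ * Vᴴ) U := by
  simp only [expect, conjTranspose_mul, mul_assoc]

theorem expect_mul' {n : ℕ} (O σ U V : Op n) : expect O σ (U * V) = expect (Uᴴ * O * U) σ V := by
  simp only [expect, conjTranspose_mul]
  rw [mul_assoc Uᴴ, mul_assoc Uᴴ, trace_mul_comm Uᴴ]
  simp only [mul_assoc]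

theorem continuous_expect {n : ℕ} (O σ : Op n) {X : Type*} [TopologicalSpace X] {f : X → Op n}
    (hf : Continuous f) : Continuous fun x => expect O σ (f x) := by
  unfold expect
  exact (continuous_const.matrix_mul ((hf.matrix_mul continuous_const).matrix_mul
    hf.matrix_conjTranspose)).matrix_trace

theorem expect_gateOp_mem {n : ℕ} (e : Fin 2 ↪ Fin n) (O σ : Op n) :
    (fun G : QU 2 => expect O σ (gateOp e G.1)) ∈ bilinearFunctions (Fin 2 → Fin 2) := by
  have h : (fun G : QU 2 => expect O σ (gateOp e G.1)) = ∑ w, ∑ x, ∑ y, ∑ z,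
      (O w x * σ y z * (if ∀ k, k ∉ Set.range e → x k = y k then 1 else 0) *
        (if ∀ k, k ∉ Set.range e → w k = z k then 1 else 0)) •
      fun G : QU 2 => G.1 (x ∘ e) (y ∘ e) * star (G.1 (w ∘ e) (z ∘ e)) := by
    funext G
    simp only [expect, Matrix.trace, Matrix.diag, Matrix.mul_apply, Finset.sum_apply, Pi.smul_apply,
      smul_eq_mul, Finset.mul_sum, Finset.sum_mul, gateOp, conjTranspose_apply, star_mul', apply_ite star,
      star_one, star_zero]
    refine Finset.sum_congr rfl fun w _ => Finset.sum_congr rfl fun x _ => ?_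
    rw [Finset.sum_comm]
    exact Finset.sum_congr rfl fun y _ => Finset.sum_congr rfl fun z _ => by ring
  rw [h]
  exact Submodule.sum_mem _ fun w _ => Submodule.sum_mem _ fun x _ => Submodule.sum_mem _ fun y _ =>
    Submodule.sum_mem _ fun z _ => Submodule.smul_mem _ _
      (Submodule.subset_span ⟨((x ∘ e, y ∘ e), (w ∘ e, z ∘ e)), rfl⟩)

/-- A unitary that commutes with the observable up to a scalar `s` multiplies expectations by `s`. -/
theorem expect_unitary_mul {n : ℕ} {T O : Op n} (hT : T ∈ unitaryGroup (Fin n → Fin 2) ℂ) {s : ℂ}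
    (h : O * T = s • (T * O)) (σ U : Op n) : expect O σ (T * U) = s * expect O σ U := by
  have h1 : Tᴴ * T = 1 := mem_unitaryGroup_iff'.mp hT
  rw [expect_mul', mul_assoc, h, Matrix.mul_smul, ← mul_assoc, h1, one_mul]
  simp [expect]

/-- The integrand has degree (2,2), so Haar measure may replace ν. Left translation by W on the j-th
qubit of the gate fixes the first expectation and negates the second, so the integral equals its
negative. -/
theorem IsTwoDesign.integral_expect_mul_eq_zero {n : ℕ} {ν : Measure (QU 2)} (hν : IsTwoDesign ν)
    (e : Fin 2 ↪ Fin n) (j : Fin 2) (W : unitaryGroup (Fin 2) ℂ) {O₁ O₂ : Op n}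
    (h₁ : O₁ * siteOp (e j) W.1 = siteOp (e j) W.1 * O₁)
    (h₂ : O₂ * siteOp (e j) W.1 = -(siteOp (e j) W.1 * O₂)) (σ : Op n) :
    ∫ G : QU 2, expect O₁ σ (gateOp e G.1) * expect O₂ σ (gateOp e G.1) ∂ν = 0 := by
  have hmem := Submodule.mul_mem_mul (expect_gateOp_mem e O₁ σ) (expect_gateOp_mem e O₂ σ)
  rw [show (∫ G : QU 2, expect O₁ σ (gateOp e G.1) * expect O₂ σ (gateOp e G.1) ∂ν)
      = ∫ G : QU 2, expect O₁ σ (gateOp e G.1) * expect O₂ σ (gateOp e G.1) ∂(haarUnitary _)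
    from hν.integral_eq hmem]
  have hinv := integral_mul_left_eq_self (μ := haarUnitary (Fin 2 → Fin 2))
    (fun G : QU 2 => expect O₁ σ (gateOp e G.1) * expect O₂ σ (gateOp e G.1))
    ⟨siteOp j W.1, siteOp_mem j W⟩
  have hflip (G : QU 2) :
      expect O₁ σ (gateOp e ((⟨siteOp j W.1, siteOp_mem j W⟩ : QU 2) * G).1) *
        expect O₂ σ (gateOp e ((⟨siteOp j W.1, siteOp_mem j W⟩ : QU 2) * G).1)
      = -(expect O₁ σ (gateOp e G.1) * expect O₂ σ (gateOp e G.1)) := by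
    rw [Submonoid.coe_mul, gateOp_mul, ← siteOp_range,
      expect_unitary_mul (siteOp_mem _ W) (s := 1) (by simpa using h₁),
      expect_unitary_mul (siteOp_mem _ W) (s := -1) (by simpa using h₂)]
    ring
  simp only [hflip, integral_neg] at hinv
  exact self_eq_neg.mp hinv.symm

theorem continuous_gateOn {n : ℕ} (e : Fin 2 ↪ Fin n) : Continuous (gateOn e) := by
  refine Continuous.subtype_mk (continuous_matrix fun x y => ?_) _
  exact (continuous_entry _ _).mul continuous_const

theorem continuous_layerUnitary {n : ℕ} (ℓ : Layout n) : Continuous (layerUnitary ℓ) := by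
  unfold layerUnitary
  simp only [List.ofFn_eq_map]
  exact continuous_list_prod _ fun i _ => (continuous_gateOn _).comp (continuous_apply i)

theorem layerUnitary_cons {n : ℕ} (e : Fin 2 ↪ Fin n) (ℓ : Layout n)
    (G : Fin (ℓ.length + 1) → QU 2) :
    layerUnitary (e :: ℓ) G = gateOn e (G 0) * layerUnitary ℓ fun i => G i.succ := by
  unfold layerUnitary
  rw [← List.prod_cons]
  congr 1
  exact List.ofFn_succ

/-- Peel gates off from the left. The first gate met that touches k gives zero by its own average;
each earlier one commutes with W at k, so it can be absorbed into the observables without changing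
their commutation relations with W. -/
theorem integral_layer_expect_mul_eq_zero {n : ℕ} {k : Fin n} (W : unitaryGroup (Fin 2) ℂ)
    (ℓ : Layout n) (hℓ : ∃ e ∈ ℓ, k ∈ Set.range e) (γ : Fin ℓ.length → Measure (QU 2))
    (hγ : ∀ i, IsTwoDesign (γ i)) {O₁ O₂ : Op n}
    (h₁ : O₁ * siteOp k W.1 = siteOp k W.1 * O₁)
    (h₂ : O₂ * siteOp k W.1 = -(siteOp k W.1 * O₂)) (σ : Op n) :
    ∫ G, expect O₁ σ (layerUnitary ℓ G).1 * expect O₂ σ (layerUnitary ℓ G).1 ∂(Measure.pi γ) = 0 := by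
  induction ℓ generalizing O₁ O₂ with
  | nil => simp at hℓ
  | cons e ℓ ih =>
    change Fin (ℓ.length + 1) → Measure (QU 2) at γ
    have hprob (i : Fin (ℓ.length + 1)) : IsProbabilityMeasure (γ i) := (hγ i).1
    have hmp := measurePreserving_piFinSuccAbove γ 0
    let H : QU 2 × (Fin ℓ.length → QU 2) → ℂ := fun z =>
      expect O₁ σ (gateOn e z.1 * layerUnitary ℓ z.2).1 *
        expect O₂ σ (gateOn e z.1 * layerUnitary ℓ z.2).1
    have hc : Continuous H := by
      have h : Continuous fun z : QU 2 × (Fin ℓ.length → QU 2) =>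
          (gateOn e z.1 * layerUnitary ℓ z.2).1 :=
        continuous_subtype_val.comp (((continuous_gateOn e).comp continuous_fst).mul
          ((continuous_layerUnitary ℓ).comp continuous_snd))
      exact (continuous_expect O₁ σ h).mul (continuous_expect O₂ σ h)
    have hH : (∫ G, expect O₁ σ (layerUnitary (e :: ℓ) G).1 * expect O₂ σ (layerUnitary (e :: ℓ) G).1
        ∂(Measure.pi γ)) = ∫ z, H z ∂((γ 0).prod (Measure.pi fun j => γ (Fin.succAbove 0 j))) := by
      rw [← hmp.integral_comp']
      refine integral_congr_ae (Filter.Eventually.of_forall fun G => ?_)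
      simp only [layerUnitary_cons]
      rfl
    refine hH.trans ?_
    by_cases hk : k ∈ Set.range e
    · obtain ⟨j, rfl⟩ := hk
      -- Integrate over the gate on k first; the remaining gates are absorbed into the state.
      rw [integral_prod_symm _ hc.integrable_of_compactSpace]
      refine integral_eq_zero_of_ae (Filter.Eventually.of_forall fun G => ?_)
      simp only [H, Submonoid.coe_mul, expect_mul]
      exact (hγ 0).integral_expect_mul_eq_zero e j W h₁ h₂ _
    -- Here the gate is frozen and conjugates the observables (Heisenberg picture), while the
    -- induction hypothesis averages over the others.
    · rw [integral_prod _ hc.integrable_of_compactSpace]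
      refine integral_eq_zero_of_ae (Filter.Eventually.of_forall fun g => ?_)
      simp only [H, Submonoid.coe_mul, expect_mul']
      have hcomm := siteOp_commute_gateOp e hk W.1 g.1
      have hcomm' := siteOp_commute_gateOp e hk W.1 g.1ᴴ
      refine ih ?_ _ (fun i => hγ i.succ) ?_ ?_
      · obtain ⟨e', he', hk'⟩ := hℓ
        rcases List.mem_cons.mp he' with rfl | he'
        · exact absurd hk' hk
        · exact ⟨e', he', hk'⟩
      · simp only [gateOn, gateOp_conjTranspose]
        rw [← mul_assoc, ← mul_assoc, hcomm', mul_assoc, ← hcomm, mul_assoc (gateOp e g.1ᴴ),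
          mul_assoc (gateOp e g.1ᴴ), ← h₁]
        simp only [mul_assoc]
      · simp only [gateOn, gateOp_conjTranspose]
        rw [← mul_assoc, ← mul_assoc, hcomm', mul_assoc, ← hcomm, mul_assoc (gateOp e g.1ᴴ),
          ← mul_assoc O₂, h₂, mul_assoc (gateOp e g.1ᴴ)]
        simp only [mul_assoc, neg_mul, mul_neg]

theorem IsLocalDesignLayer.isProbabilityMeasure {n : ℕ} {ν : Measure (QU n)}
    (hν : IsLocalDesignLayer ν) : IsProbabilityMeasure ν := by
  obtain ⟨p, γ, -, hγ, rfl⟩ := hν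
  have hprob (ℓ : Layout n) (i : Fin ℓ.length) : IsProbabilityMeasure (γ ℓ i) := (hγ ℓ i).1
  refine ⟨?_⟩
  rw [Measure.sum_apply _ MeasurableSet.univ]
  have (ℓ : Layout n) : ((Measure.pi (γ ℓ)).map (layerUnitary ℓ)) Set.univ = 1 := by
    rw [Measure.map_apply (continuous_layerUnitary ℓ).measurable MeasurableSet.univ]
    simp
  simp [this, p.tsum_coe]

theorem IsLocalDesignLayer.integral_expect_mul_eq_zero {n : ℕ} {ν : Measure (QU n)}
    (hν : IsLocalDesignLayer ν) (k : Fin n) (W : unitaryGroup (Fin 2) ℂ) {O₁ O₂ : Op n}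
    (h₁ : O₁ * siteOp k W.1 = siteOp k W.1 * O₁)
    (h₂ : O₂ * siteOp k W.1 = -(siteOp k W.1 * O₂)) (σ : Op n) :
    ∫ U : QU n, expect O₁ σ U.1 * expect O₂ σ U.1 ∂ν = 0 := by
  have := hν.isProbabilityMeasure
  obtain ⟨p, γ, hp, hγ, hsum⟩ := hν
  have hc : Continuous fun U : QU n => expect O₁ σ U.1 * expect O₂ σ U.1 :=
    (continuous_expect O₁ σ continuous_subtype_val).mul
      (continuous_expect O₂ σ continuous_subtype_val)
  have hint : Integrable (fun U : QU n => expect O₁ σ U.1 * expect O₂ σ U.1) ν :=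
    hc.integrable_of_compactSpace
  rw [hsum] at hint ⊢
  rw [integral_sum_measure hint]
  refine (tsum_congr fun ℓ => ?_).trans tsum_zero
  rw [integral_smul_measure]
  by_cases hℓ : ℓ ∈ p.support
  · rw [integral_map (continuous_layerUnitary ℓ).aemeasurable hc.aestronglyMeasurable,
      integral_layer_expect_mul_eq_zero W ℓ (hp ℓ hℓ k) (γ ℓ) (hγ ℓ) h₁ h₂, smul_zero]
  -- A layout outside the support may leave k uncovered, but it has weight zero.
  · rw [(p.apply_eq_zero_iff ℓ).mpr hℓ]
    simp

/-! ## Purity in the Pauli basis -/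

theorem norm_sq_eq_sum (t : EuclideanSpace ℝ (Fin 3)) : ‖t‖ ^ 2 = ∑ q, t q ^ 2 :=
  EuclideanSpace.real_norm_sq_eq t

section Kernel

variable (N : Op1 →ₗ[ℂ] Op1) (V : unitaryGroup (Fin 2) ℂ)

/-- The contribution of qubit `i` to the purity of the reduced state on `S`. -/
def siteKernel {n : ℕ} (S : Finset (Fin n)) (i : Fin n) (p q : Option (Fin 3)) : ℂ :=
  if i ∈ S then (N (rotPauli V p) * N (rotPauli V q)).trace
  else (N (rotPauli V p)).trace * (N (rotPauli V q)).trace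

/-- The reduced output depends linearly on B and sends a product string to a product operator, so
the trace factors over sites. Each final gate cancels at its own site by cyclicity of the trace. The
two expansions contribute 2^{-n} each. -/
theorem trace_reduced_mul_self {n : ℕ} (S : Finset (Fin n)) (v : Fin n → unitaryGroup (Fin 2) ℂ)
    (B : Op n) :
    (reduced S (tensorUnitary v * tensorChannel N B * (tensorUnitary v)ᴴ) *
        reduced S (tensorUnitary v * tensorChannel N B * (tensorUnitary v)ᴴ)).trace
      = ((4 : ℂ) ^ n)⁻¹ * ∑ P, ∑ Q, (pauliString V P * B).trace * (pauliString V Q * B).trace *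
          ∏ i, siteKernel N V S i (P i) (Q i) := by
  let Λ : Op n →ₗ[ℂ] Matrix (S → Fin 2) (S → Fin 2) ℂ :=
    reducedLin S ∘ₗ LinearMap.mulRight ℂ (tensorUnitary v)ᴴ ∘ₗ
      LinearMap.mulLeft ℂ (tensorUnitary v) ∘ₗ tensorChannelLin N n
  have hΛP (P : Fin n → Option (Fin 3)) : Λ (pauliString V P)
      = (∏ k : {k // k ∉ S}, (N (rotPauli V (P k))).trace) •
        tensorOp (fun k : S => (v k).1 * N (rotPauli V (P k)) * (v k).1ᴴ) := by
    change reduced S (tensorUnitary v * tensorChannel N (pauliString V P) * (tensorUnitary v)ᴴ) = _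
    rw [pauliString, tensorChannel_tensorOp, tensorUnitary_eq, tensorOp_conjTranspose, tensorOp_mul,
      tensorOp_mul, reduced_tensorOp]
    congr 1
    refine Finset.prod_congr rfl fun k _ => ?_
    rw [trace_mul_comm, ← mul_assoc, unitary_conj_mul, one_mul]
  have hPQ (P Q : Fin n → Option (Fin 3)) : (Λ (pauliString V P) * Λ (pauliString V Q)).trace
      = ∏ i, siteKernel N V S i (P i) (Q i) := by
    rw [hΛP, hΛP, Matrix.smul_mul, Matrix.mul_smul, trace_smul, trace_smul, tensorOp_mul,
      trace_tensorOp, smul_eq_mul, smul_eq_mul, ← mul_assoc, ← Finset.prod_mul_distrib,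
      ← Fintype.prod_subtype_mul_prod_subtype (fun k => k ∈ S), mul_comm]
    congr 1
    · refine Finset.prod_congr (by ext; simp) fun k _ => ?_
      rw [conj_mul_conj, trace_mul_comm, ← mul_assoc, unitary_conj_mul, one_mul, siteKernel,
        if_pos k.2]
    · refine Finset.prod_congr (by ext; simp) fun k _ => ?_
      rw [siteKernel, if_neg k.2]
  change (Λ B * Λ B).trace = _
  have hB : Λ B = ((2 : ℂ) ^ n)⁻¹ • ∑ P, (pauliString V P * B).trace • Λ (pauliString V P) := by
    conv_lhs => rw [pauliString_expansion V B]
    simp only [map_smul, map_sum]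
  rw [hB, Matrix.smul_mul, Matrix.mul_smul, smul_smul, trace_smul, smul_eq_mul, ← mul_inv,
    ← mul_pow]
  norm_num only
  simp only [Matrix.sum_mul, Matrix.mul_sum, trace_sum, Matrix.smul_mul, Matrix.mul_smul, trace_smul,
    hPQ, smul_eq_mul]
  rw [Finset.sum_comm]
  simp only [Finset.mul_sum]
  exact Finset.sum_congr rfl fun P _ => Finset.sum_congr rfl fun Q _ => by ring

end Kernel

/-- The diagonal values of `siteKernel`. -/
def siteWeight (t D : EuclideanSpace ℝ (Fin 3)) {n : ℕ} (S : Finset (Fin n)) (i : Fin n) :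
    Option (Fin 3) → ℝ
  | none => if i ∈ S then 2 * (1 + ‖t‖ ^ 2) else 4
  | some q => if i ∈ S then 2 * D q ^ 2 else 0

theorem siteWeight_nonneg (t D : EuclideanSpace ℝ (Fin 3)) {n : ℕ} (S : Finset (Fin n)) (i : Fin n)
    (q : Option (Fin 3)) : 0 ≤ siteWeight t D S i q := by
  cases q <;> simp only [siteWeight] <;> split_ifs <;> positivity

theorem sum_siteWeight (t D : EuclideanSpace ℝ (Fin 3)) {n : ℕ} (S : Finset (Fin n)) (i : Fin n) :
    ∑ q, siteWeight t D S i q = if i ∈ S then 2 * (1 + ‖t‖ ^ 2 + ‖D‖ ^ 2) else 4 := by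
  rw [Fintype.sum_option]
  simp only [siteWeight]
  split_ifs
  · rw [norm_sq_eq_sum D, ← Finset.mul_sum]
    ring
  · simp

/-- Distributes one factor 1/4 to each site: a traced-out site then contributes 1 and a kept site
a/2. -/
theorem inv_four_pow_mul_prod_ite {n : ℕ} (S : Finset (Fin n)) (a : ℝ) :
    ((4 : ℝ) ^ n)⁻¹ * ∏ i : Fin n, (if i ∈ S then 2 * a else 4) = (a / 2) ^ S.card := by
  have h : ((4 : ℝ) ^ n)⁻¹ = ∏ _i : Fin n, (4 : ℝ)⁻¹ := by simp
  rw [h, ← Finset.prod_mul_distrib]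
  have h2 (i : Fin n) : (4 : ℝ)⁻¹ * (if i ∈ S then 2 * a else 4) = if i ∈ S then a / 2 else 1 := by
    split_ifs <;> ring
  simp [h2, div_pow]

/-- In the basis rotated by V the noise acts as N' up to conjugation by U, which every trace
forgets. Orthogonality of the Paulis does the rest. Mixed entries between the identity and a Pauli
are not claimed to vanish, since t and D can couple them; twirling handles those. -/
theorem HasNormalForm.exists_siteKernel {N : Op1 →ₗ[ℂ] Op1} {t D : EuclideanSpace ℝ (Fin 3)}
    (h : HasNormalForm N t D) : ∃ V : unitaryGroup (Fin 2) ℂ, ∀ {n : ℕ} (S : Finset (Fin n)) i,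
      (∀ q, siteKernel N V S i q q = (siteWeight t D S i q : ℂ)) ∧
      ∀ p q, p ≠ none → q ≠ none → p ≠ q → siteKernel N V S i p q = 0 := by
  obtain ⟨U, V, N', hN, h1, hq⟩ := h
  have hrot (q) : N (rotPauli V q) = U.1 * N' (pauliBasis q) * U.1ᴴ := by
    rw [hN, rotPauli]
    congr 3
    calc V.1ᴴ * (V.1 * pauliBasis q * V.1ᴴ) * V.1
        = (V.1ᴴ * V.1) * pauliBasis q * (V.1ᴴ * V.1) := by noncomm_ring
      _ = _ := by rw [unitary_conj_mul]; simp
  have htr (A : Op1) : (U.1 * A * U.1ᴴ).trace = A.trace := by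
    rw [trace_mul_comm, ← mul_assoc, unitary_conj_mul, one_mul]
  have hdd (p q : Fin 3) : (N' (pauli p) * N' (pauli q)).trace
      = if p = q then ((2 * D q ^ 2 : ℝ) : ℂ) else 0 := by
    rw [hq, hq, Matrix.smul_mul, Matrix.mul_smul, trace_smul, trace_smul, trace_pauli_mul]
    split_ifs with h
    · subst h
      push_cast
      simp only [smul_eq_mul]
      ring
    · simp
  have hd (q : Fin 3) : (N' (pauli q)).trace = 0 := by
    rw [hq, trace_smul, trace_pauli, smul_zero]
  have h0 : (N' 1).trace = 2 := by
    simp [h1, trace_sum, trace_pauli]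
  have h00 : (N' 1 * N' 1).trace = ((2 * (1 + ‖t‖ ^ 2) : ℝ) : ℂ) := by
    have hX : ((∑ q, (t q : ℂ) • pauli q) * ∑ q, (t q : ℂ) • pauli q).trace
        = 2 * ∑ q, (t q : ℂ) ^ 2 := by
      simp only [Matrix.sum_mul, trace_sum, Matrix.smul_mul, Matrix.mul_smul,
        trace_smul, trace_pauli_mul, smul_eq_mul, mul_ite, mul_zero, Finset.sum_ite_eq',
        Finset.mem_univ, if_true, Finset.mul_sum]
      exact Finset.sum_congr rfl fun q _ => by ring
    have hX1 : (∑ q, (t q : ℂ) • pauli q).trace = 0 := by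
      simp [trace_sum, trace_pauli]
    rw [h1, add_mul, mul_add, mul_add, one_mul, mul_one, one_mul, trace_add, trace_add, trace_add, hX, hX1,
      norm_sq_eq_sum]
    push_cast
    simp
    ring
  refine ⟨V, fun S i => ⟨fun q => ?_, fun p q hp hq' hpq => ?_⟩⟩
  · simp only [siteKernel, hrot, conj_mul_conj, htr]
    cases q with
    | none =>
      simp only [siteWeight, pauliBasis, h0, h00]
      split_ifs
      · rfl
      · norm_num
    | some q =>
      simp only [siteWeight, pauliBasis, hd, hdd, if_true]
      split_ifs <;> simp
  · obtain ⟨p, rfl⟩ := Option.ne_none_iff_exists'.mp hp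
    obtain ⟨q, rfl⟩ := Option.ne_none_iff_exists'.mp hq'
    have hpq' : p ≠ q := fun h => hpq (congrArg some h)
    simp only [siteKernel, hrot, conj_mul_conj, htr, pauliBasis, hd, hdd, if_neg hpq']
    simp

/-! ## Averages over the last layer -/

theorem pauliString_mul_siteOp_of_none (V : unitaryGroup (Fin 2) ℂ) {n : ℕ}
    {P : Fin n → Option (Fin 3)} {k : Fin n} (hk : P k = none) (W : Op1) :
    pauliString V P * siteOp k W = siteOp k W * pauliString V P := by
  rw [pauliString, siteOp, tensorOp_mul, tensorOp_mul]
  congr 1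
  funext i
  by_cases h : i = k
  · subst h
    simp [hk, rotPauli_none]
  · simp [h]

theorem rotPauli_succ_anticomm (V : unitaryGroup (Fin 2) ℂ) (q : Fin 3) :
    rotPauli V (some q) * rotPauli V (some (q + 1))
      = -(rotPauli V (some (q + 1)) * rotPauli V (some q)) := by
  have h := rotPauli_anticomm V q
  rw [rotPauli_conjTranspose] at h
  have h2 := congrArg (rotPauli V (some (q + 1)) * ·) h
  simp only [← mul_assoc, rotPauli_mul_self, one_mul, mul_neg] at h2
  exact h2

theorem pauliString_mul_siteOp_of_some (V : unitaryGroup (Fin 2) ℂ) {n : ℕ}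
    {P : Fin n → Option (Fin 3)} {k : Fin n} {q : Fin 3} (hk : P k = some q) :
    pauliString V P * siteOp k (rotPauli V (some (q + 1)))
      = -(siteOp k (rotPauli V (some (q + 1))) * pauliString V P) := by
  rw [pauliString, siteOp, tensorOp_mul, tensorOp_mul, ← neg_one_smul ℂ (tensorOp _)]
  have h : (-1 : ℂ) = ∏ i, if i = k then -1 else 1 := by simp
  rw [h, ← tensorOp_smul]
  congr 1
  funext i
  by_cases h : i = k
  · subst h
    simp [hk, rotPauli_succ_anticomm]
  · simp [h]

theorem IsLocalDesignLayer.integral_pauliString_eq_zero {n : ℕ} {ν : Measure (QU n)}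
    (hν : IsLocalDesignLayer ν) (V : unitaryGroup (Fin 2) ℂ) {P Q : Fin n → Option (Fin 3)}
    {k : Fin n} (hP : P k = none) (hQ : Q k ≠ none) (σ : Op n) :
    ∫ U : QU n, expect (pauliString V P) σ U.1 * expect (pauliString V Q) σ U.1 ∂ν = 0 := by
  obtain ⟨q, hq⟩ := Option.ne_none_iff_exists'.mp hQ
  exact hν.integral_expect_mul_eq_zero k ⟨_, rotPauli_mem V (some (q + 1))⟩
    (pauliString_mul_siteOp_of_none V hP _) (pauliString_mul_siteOp_of_some V hq) σ

theorem exists_one_none_of_prod_ne_zero {n : ℕ} {κ : Fin n → Option (Fin 3) → Option (Fin 3) → ℂ}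
    (hκ : ∀ i p q, p ≠ none → q ≠ none → p ≠ q → κ i p q = 0) {P Q : Fin n → Option (Fin 3)}
    (hPQ : P ≠ Q) (h : ∏ i, κ i (P i) (Q i) ≠ 0) :
    ∃ k, (P k = none ∧ Q k ≠ none) ∨ (Q k = none ∧ P k ≠ none) := by
  obtain ⟨k, hk⟩ := Function.ne_iff.mp hPQ
  have := Finset.prod_ne_zero_iff.mp h k (Finset.mem_univ k)
  refine ⟨k, ?_⟩
  by_cases hP : P k = none
  · exact Or.inl ⟨hP, fun hQ => hk (hP.trans hQ.symm)⟩
  · by_cases hQ : Q k = none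
    · exact Or.inr ⟨hQ, hP⟩
    · exact absurd (hκ k _ _ hP hQ hk) this

/-- The second moment of a Pauli expectation value lies in `[0, 1]`. -/
theorem exists_second_moment {n : ℕ} (ν : Measure (QU n)) [IsProbabilityMeasure ν]
    (V : unitaryGroup (Fin 2) ℂ) (P : Fin n → Option (Fin 3)) {σ : Op n} (hσ : IsState σ) :
    ∃ e : ℝ, ∫ U : QU n, expect (pauliString V P) σ U.1 * expect (pauliString V P) σ U.1 ∂ν = e ∧
      0 ≤ e ∧ e ≤ 1 := by
  have h (U : QU n) := expectation_involution (pauliString_conjTranspose V P)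
    (pauliString_mul_self V P) (hσ.unitary_conj U).1 (hσ.unitary_conj U).2
  choose r hr hr1 using h
  refine ⟨∫ U, r U ^ 2 ∂ν, ?_, integral_nonneg fun U => sq_nonneg _, ?_⟩
  · rw [← integral_complex_ofReal]
    refine integral_congr_ae (Filter.Eventually.of_forall fun U => ?_)
    simp only [expect, hr]
    push_cast
    ring
  · refine (integral_mono_of_nonneg (Filter.Eventually.of_forall fun U => sq_nonneg _)
      (integrable_const (1 : ℝ)) (Filter.Eventually.of_forall hr1)).trans ?_
    simp

/-! ### Continuity of the circuit operations, which gives integrability over compact unitary groups.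
-/

section Continuity

variable {X : Type*} [TopologicalSpace X] {n : ℕ} {f g : X → Op n}

theorem continuous_tensorChannel (N : Op1 →ₗ[ℂ] Op1) (hf : Continuous f) :
    Continuous fun x => tensorChannel N (f x) := by
  refine continuous_matrix fun i j => ?_
  exact continuous_finsetSum _ fun a _ => continuous_finsetSum _ fun b _ =>
    (hf.matrix_elem a b).mul continuous_const

theorem continuous_reduced (S : Finset (Fin n)) (hf : Continuous f) :
    Continuous fun x => reduced S (f x) := by
  refine continuous_matrix fun i j => ?_
  exact continuous_finsetSum _ fun a _ => hf.matrix_elem _ _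

theorem continuous_purity {d : Type*} [Fintype d] {f : X → Matrix d d ℂ} (hf : Continuous f) :
    Continuous fun x => purity (f x) :=
  Complex.continuous_re.comp (hf.matrix_mul hf).matrix_trace

theorem continuous_conj (hf : Continuous f) (hg : Continuous g) :
    Continuous fun x => f x * g x * (f x)ᴴ :=
  (hf.matrix_mul hg).matrix_mul hf.matrix_conjTranspose

end Continuity

/-- The output of a last layer `U`, noise, and final single-qubit gates `v` on the input `σ`. -/
def lastLayer (N : Op1 →ₗ[ℂ] Op1) {n : ℕ} (v : Fin n → unitaryGroup (Fin 2) ℂ) (σ U : Op n) : Op n :=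
  tensorUnitary v * tensorChannel N (U * σ * Uᴴ) * (tensorUnitary v)ᴴ

theorem IsLocalDesignLayer.integral_purity {N : Op1 →ₗ[ℂ] Op1} {t D : EuclideanSpace ℝ (Fin 3)}
    (hform : HasNormalForm N t D) {n : ℕ} {ν : Measure (QU n)} (hν : IsLocalDesignLayer ν)
    (S : Finset (Fin n)) (v : Fin n → unitaryGroup (Fin 2) ℂ) {σ : Op n} (hσ : IsState σ) :
    ∃ e : (Fin n → Option (Fin 3)) → ℝ, (∀ P, 0 ≤ e P ∧ e P ≤ 1) ∧ e (fun _ => none) = 1 ∧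
      ∫ U : QU n, purity (reduced S (lastLayer N v σ U.1)) ∂ν
        = ((4 : ℝ) ^ n)⁻¹ * ∑ P, e P * ∏ i, siteWeight t D S i (P i) := by
  have := hν.isProbabilityMeasure
  obtain ⟨V, hV⟩ := hform.exists_siteKernel
  choose e he he01 using fun P => exists_second_moment ν V P hσ
  refine ⟨e, he01, ?_, ?_⟩
  · have h := he fun _ => none
    have h1 (U : QU n) : expect (pauliString V fun _ => none) σ U.1 = 1 := by
      rw [expect, pauliString_none, one_mul]
      exact (hσ.unitary_conj U).2
    simp only [h1] at h
    simp at h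
    exact_mod_cast h.symm
  have hcont (P Q : Fin n → Option (Fin 3)) : Continuous fun U : QU n =>
      expect (pauliString V P) σ U.1 * expect (pauliString V Q) σ U.1 :=
    (continuous_expect _ σ continuous_subtype_val).mul (continuous_expect _ σ continuous_subtype_val)
  have hint (P Q : Fin n → Option (Fin 3)) : Integrable (fun U : QU n =>
      expect (pauliString V P) σ U.1 * expect (pauliString V Q) σ U.1 *
        ∏ i, siteKernel N V S i (P i) (Q i)) ν :=
    ((hcont P Q).mul continuous_const).integrable_of_compactSpace
  have hsum : ∫ U : QU n, (reduced S (lastLayer N v σ U.1) * reduced S (lastLayer N v σ U.1)).trace ∂ν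
      = ((((4 : ℝ) ^ n)⁻¹ * ∑ P, e P * ∏ i, siteWeight t D S i (P i) : ℝ) : ℂ) := by
    have hE (O U : Op n) : (O * (U * σ * Uᴴ)).trace = expect O σ U := rfl
    simp only [lastLayer, trace_reduced_mul_self N V S v, hE]
    rw [integral_const_mul, integral_finsetSum _ fun P _ => integrable_finsetSum _ fun Q _ => hint P Q]
    push_cast
    congr 1
    refine Finset.sum_congr rfl fun P _ => ?_
    rw [integral_finsetSum _ fun Q _ => hint P Q, Finset.sum_eq_single P]
    · rw [integral_mul_const]
      simp only [fun i => (hV S i).1]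
      congr 1
      exact he P
    · intro Q _ hQP
      rw [integral_mul_const]
      -- A cross term dies either through its site product or, when that is nonzero, through the
      -- average: some site then carries the identity in exactly one of P and Q.
      by_cases h0 : ∏ i, siteKernel N V S i (P i) (Q i) = 0
      · rw [h0, mul_zero]
      obtain ⟨k, hk | hk⟩ := exists_one_none_of_prod_ne_zero (fun i => (hV S i).2) hQP.symm h0
      · exact mul_eq_zero_of_left (hν.integral_pauliString_eq_zero V hk.1 hk.2 σ) _
      · refine mul_eq_zero_of_left (Eq.trans ?_ (hν.integral_pauliString_eq_zero V hk.1 hk.2 σ)) _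
        exact integral_congr_ae (Filter.Eventually.of_forall fun U => mul_comm _ _)
    · simp
  have hc : Continuous fun U : QU n =>
      (reduced S (lastLayer N v σ U.1) * reduced S (lastLayer N v σ U.1)).trace := by
    have h : Continuous fun U : QU n => reduced S (lastLayer N v σ U.1) :=
      continuous_reduced S (continuous_conj continuous_const (continuous_tensorChannel N
        (continuous_conj continuous_subtype_val continuous_const)))
    exact (h.matrix_mul h).matrix_trace
  have hi : Integrable (fun U : QU n =>
      (reduced S (lastLayer N v σ U.1) * reduced S (lastLayer N v σ U.1)).trace) ν :=
    hc.integrable_of_compactSpace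
  -- The purity is a real part, and taking real parts commutes with the integral.
  have hre := Complex.reCLM.integral_comp_comm hi
  rw [hsum] at hre
  exact hre

theorem IsLocalDesignLayer.integral_purity_bounds {N : Op1 →ₗ[ℂ] Op1}
    {t D : EuclideanSpace ℝ (Fin 3)} (hform : HasNormalForm N t D) {n : ℕ} {ν : Measure (QU n)}
    (hν : IsLocalDesignLayer ν) (S : Finset (Fin n)) (v : Fin n → unitaryGroup (Fin 2) ℂ) {σ : Op n}
    (hσ : IsState σ) :
    ((1 + ‖t‖ ^ 2) / 2) ^ S.card ≤ ∫ U : QU n, purity (reduced S (lastLayer N v σ U.1)) ∂ν ∧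
      ∫ U : QU n, purity (reduced S (lastLayer N v σ U.1)) ∂ν
        ≤ ((1 + ‖t‖ ^ 2 + ‖D‖ ^ 2) / 2) ^ S.card := by
  obtain ⟨e, he, he1, h⟩ := hν.integral_purity hform S v hσ
  have hw (P : Fin n → Option (Fin 3)) : 0 ≤ ∏ i, siteWeight t D S i (P i) :=
    Finset.prod_nonneg fun i _ => siteWeight_nonneg t D S i _
  rw [h]
  constructor
  · rw [← inv_four_pow_mul_prod_ite]
    refine mul_le_mul_of_nonneg_left ?_ (by positivity)
    -- Lower bound: all terms are nonnegative, and only the identity string, with moment 1, is kept.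
    have h1 := Finset.single_le_sum (f := fun P => e P * ∏ i, siteWeight t D S i (P i))
      (fun P _ => mul_nonneg (he P).1 (hw P)) (Finset.mem_univ fun _ => none)
    simpa only [he1, one_mul, siteWeight] using h1
  · rw [← inv_four_pow_mul_prod_ite]
    refine mul_le_mul_of_nonneg_left ?_ (by positivity)
    -- Upper bound: the product of the site sums is the sum over all strings with every moment
    -- replaced by 1.
    simp only [← sum_siteWeight, Fintype.prod_sum]
    exact Finset.sum_le_sum fun P _ => mul_le_of_le_one_left (hw P) (he P).2

/-! ## Averages over the whole circuit -/

theorem integral_mem_Icc {X : Type*} [MeasurableSpace X] {μ : Measure X} [IsProbabilityMeasure μ]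
    {f : X → ℝ} (hf : Integrable f μ) {a b : ℝ} (h : ∀ x, a ≤ f x ∧ f x ≤ b) :
    a ≤ ∫ x, f x ∂μ ∧ ∫ x, f x ∂μ ≤ b := by
  constructor
  · simpa using integral_mono (integrable_const a) hf fun x => (h x).1
  · simpa using integral_mono hf (integrable_const b) fun x => (h x).2

theorem continuous_noisyLayers (N : Op1 →ₗ[ℂ] Op1) {n : ℕ} (ρ : Op n) :
    ∀ L : ℕ, Continuous fun U : Fin L → QU n => noisyLayers N L U ρ
  | 0 => continuous_const
  | L + 1 => by
    have h : Continuous fun U : Fin (L + 1) → QU n => noisyLayers N L (fun l => U l.castSucc) ρ :=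
      (continuous_noisyLayers N ρ L).comp (continuous_pi fun l => continuous_apply _)
    exact continuous_tensorChannel N (continuous_conj
      (continuous_subtype_val.comp (continuous_apply (Fin.last L))) h)

theorem continuous_tensorUnitary {n : ℕ} :
    Continuous (tensorUnitary : (Fin n → unitaryGroup (Fin 2) ℂ) → Op n) :=
  continuous_matrix fun x y => continuous_finsetProd _ fun i _ =>
    (continuous_entry (x i) (y i)).comp (continuous_apply i)

theorem continuous_circuit (N : Op1 →ₗ[ℂ] Op1) {n L : ℕ} (ρ : Op n) :
    Continuous fun g : Gates n L => circuit N g ρ :=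
  continuous_conj (continuous_tensorUnitary.comp continuous_snd)
    ((continuous_noisyLayers N ρ L).comp continuous_fst)

theorem continuous_purity_circuit (N : Op1 →ₗ[ℂ] Op1) {n L : ℕ} (ρ : Op n) :
    Continuous fun g : Gates n L => purity (circuit N g ρ) :=
  continuous_purity (continuous_circuit N ρ)

theorem continuous_purity_reduced_circuit (N : Op1 →ₗ[ℂ] Op1) {n L : ℕ} (ρ : Op n)
    (S : Finset (Fin n)) : Continuous fun g : Gates n L => purity (reduced S (circuit N g ρ)) :=
  continuous_purity (continuous_reduced S (continuous_circuit N ρ))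

theorem IsCircuitLaw.isProbabilityMeasure {n L : ℕ} {P : Measure (Gates n L)}
    (hP : IsCircuitLaw P) : IsProbabilityMeasure P := by
  obtain ⟨ν, μ, hν, hμ, rfl⟩ := hP
  have hν' (l : Fin L) : IsProbabilityMeasure (ν l) := (hν l).isProbabilityMeasure
  have hμ' (i : Fin n) : IsProbabilityMeasure (μ i) := (hμ i).1
  infer_instance

theorem circuit_succ (N : Op1 →ₗ[ℂ] Op1) {n L : ℕ} (U : Fin (L + 1) → QU n)
    (v : Fin n → unitaryGroup (Fin 2) ℂ) (ρ : Op n) :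
    circuit N (U, v) ρ
      = lastLayer N v (noisyLayers N L (fun l => U l.castSucc) ρ) (U (Fin.last L)).1 := rfl

theorem integral_pi_last {n L : ℕ} (ν : Fin (L + 1) → Measure (QU n))
    [∀ l, IsProbabilityMeasure (ν l)] {H : QU n × (Fin L → QU n) → ℝ} :
    ∫ U : Fin (L + 1) → QU n, H (U (Fin.last L), fun l => U l.castSucc) ∂(Measure.pi ν)
      = ∫ z, H z ∂((ν (Fin.last L)).prod (Measure.pi fun l => ν ((Fin.last L).succAbove l))) := by
  rw [← (measurePreserving_piFinSuccAbove ν (Fin.last L)).integral_comp']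
  refine integral_congr_ae (Filter.Eventually.of_forall fun U => congrArg H ?_)
  refine Prod.ext rfl (funext fun l => ?_)
  change _ = U ((Fin.last L).succAbove l)
  rw [Fin.succAbove_last]

theorem integral_layers_purity_reduced_bounds {N : Op1 →ₗ[ℂ] Op1}
    {t D : EuclideanSpace ℝ (Fin 3)} (hN : IsChannel N) (hform : HasNormalForm N t D) {n L : ℕ}
    {ν : Fin (L + 1) → Measure (QU n)} (hν : ∀ l, IsLocalDesignLayer (ν l)) {ρ : Op n}
    (hρ : IsState ρ) (S : Finset (Fin n)) (v : Fin n → unitaryGroup (Fin 2) ℂ) :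
    ((1 + ‖t‖ ^ 2) / 2) ^ S.card ≤ ∫ U, purity (reduced S (circuit N (U, v) ρ)) ∂(Measure.pi ν) ∧
      ∫ U, purity (reduced S (circuit N (U, v) ρ)) ∂(Measure.pi ν)
        ≤ ((1 + ‖t‖ ^ 2 + ‖D‖ ^ 2) / 2) ^ S.card := by
  have hν' (l : Fin (L + 1)) : IsProbabilityMeasure (ν l) := (hν l).isProbabilityMeasure
  let H : QU n × (Fin L → QU n) → ℝ := fun z =>
    purity (reduced S (lastLayer N v (noisyLayers N L z.2 ρ) z.1.1))
  have hH : Continuous H :=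
    continuous_purity (continuous_reduced S (continuous_conj continuous_const
      (continuous_tensorChannel N (continuous_conj (continuous_subtype_val.comp continuous_fst)
        ((continuous_noisyLayers N ρ L).comp continuous_snd)))))
  have hHi : Integrable H ((ν (Fin.last L)).prod (Measure.pi fun l => ν ((Fin.last L).succAbove l))) :=
    hH.integrable_of_compactSpace
  simp only [circuit_succ]
  rw [integral_pi_last ν (H := H), integral_prod_symm H hHi]
  -- With the earlier layers W frozen, their output is still a state, so the last-layer bounds hold
  -- with constants independent of W.
  have hb (W : Fin L → QU n) : ((1 + ‖t‖ ^ 2) / 2) ^ S.card ≤ ∫ U, H (U, W) ∂(ν (Fin.last L)) ∧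
      ∫ U, H (U, W) ∂(ν (Fin.last L)) ≤ ((1 + ‖t‖ ^ 2 + ‖D‖ ^ 2) / 2) ^ S.card :=
    IsLocalDesignLayer.integral_purity_bounds (σ := noisyLayers N L W ρ) hform (hν (Fin.last L)) S v
      (hρ.noisyLayers hN L W)
  have hr : Integrable (fun W => ∫ U, H (U, W) ∂(ν (Fin.last L)))
      (Measure.pi fun l => ν ((Fin.last L).succAbove l)) := hHi.integral_prod_right
  exact integral_mem_Icc hr hb

theorem IsCircuitLaw.integral_purity_reduced_bounds {N : Op1 →ₗ[ℂ] Op1}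
    {t D : EuclideanSpace ℝ (Fin 3)} (hN : IsChannel N) (hform : HasNormalForm N t D) {n L : ℕ}
    (hL : 1 ≤ L) {P : Measure (Gates n L)} (hP : IsCircuitLaw P) {ρ : Op n} (hρ : IsState ρ)
    (S : Finset (Fin n)) :
    ((1 + ‖t‖ ^ 2) / 2) ^ S.card ≤ ∫ g, purity (reduced S (circuit N g ρ)) ∂P ∧
      ∫ g, purity (reduced S (circuit N g ρ)) ∂P ≤ ((1 + ‖t‖ ^ 2 + ‖D‖ ^ 2) / 2) ^ S.card := by
  -- Depth at least one guarantees a last layer to average over.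
  obtain ⟨L, rfl⟩ := Nat.exists_eq_add_of_le' hL
  have := hP.isProbabilityMeasure
  have hint : Integrable (fun g : Gates n (L + 1) => purity (reduced S (circuit N g ρ))) P :=
    (continuous_purity_reduced_circuit N ρ S).integrable_of_compactSpace
  obtain ⟨ν, μ, hν, hμ, rfl⟩ := hP
  have hν' (l : Fin (L + 1)) : IsProbabilityMeasure (ν l) := (hν l).isProbabilityMeasure
  have hμ' (i : Fin n) : IsProbabilityMeasure (μ i) := (hμ i).1
  rw [integral_prod_symm _ hint]
  exact integral_mem_Icc hint.integral_prod_right fun v =>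
    integral_layers_purity_reduced_bounds hN hform hν hρ S v

theorem purity_reduced_univ {n : ℕ} (A : Op n) : purity (reduced Finset.univ A) = purity A := by
  let e : ({k // k ∈ Finset.univ (α := Fin n)} → Fin 2) ≃ (Fin n → Fin 2) :=
    Equiv.arrowCongr (Equiv.subtypeUnivEquiv Finset.mem_univ) (Equiv.refl _)
  have h : reduced Finset.univ A = A.submatrix e e := by
    ext x y
    have : IsEmpty {k : Fin n // k ∉ Finset.univ} := ⟨fun k => k.2 (Finset.mem_univ _)⟩
    rw [reduced, Fintype.sum_unique, submatrix_apply]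
    congr 1 <;> funext k <;> simp [e, Equiv.subtypeUnivEquiv]
  rw [purity, purity, h, submatrix_mul_equiv]
  congr 1
  exact Equiv.sum_comp e fun x => (A * A) x x

theorem IsCircuitLaw.integral_purity_bounds {N : Op1 →ₗ[ℂ] Op1}
    {t D : EuclideanSpace ℝ (Fin 3)} (hN : IsChannel N) (hform : HasNormalForm N t D) {n L : ℕ}
    (hL : 1 ≤ L) {P : Measure (Gates n L)} (hP : IsCircuitLaw P) {ρ : Op n} (hρ : IsState ρ) :
    ((1 + ‖t‖ ^ 2) / 2) ^ n ≤ ∫ g, purity (circuit N g ρ) ∂P ∧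
      ∫ g, purity (circuit N g ρ) ∂P ≤ ((1 + ‖t‖ ^ 2 + ‖D‖ ^ 2) / 2) ^ n := by
  simpa [purity_reduced_univ] using hP.integral_purity_reduced_bounds hN hform hL hρ Finset.univ

/-! ## The fidelity kernel -/

theorem IsState.circuit {N : Op1 →ₗ[ℂ] Op1} (hN : IsChannel N) {n L : ℕ} {ρ : Op n}
    (hρ : IsState ρ) (g : Gates n L) : IsState (circuit N g ρ) :=
  (hρ.noisyLayers hN L g.1).unitary_conj ⟨tensorUnitary g.2, tensorOp_mem fun i => (g.2 i).2⟩

/-- Expand Tr[(A − B)²] ≥ 0. Bounding the kernel this way makes the two circuits separate before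
averaging. -/
theorem trace_mul_re_le {d : Type*} [Fintype d] {A B : Matrix d d ℂ} (hA : A.IsHermitian)
    (hB : B.IsHermitian) : (A * B).trace.re ≤ (purity A + purity B) / 2 := by
  have h := (posSemidef_conjTranspose_mul_self (A - B)).trace_nonneg
  rw [(hA.sub hB).eq, sub_mul, mul_sub, mul_sub, trace_sub, trace_sub, trace_sub,
    trace_mul_comm B A] at h
  have h1 := (Complex.nonneg_iff.mp h).1
  simp only [Complex.sub_re] at h1
  unfold purity
  linarith

section Fidelity

variable (N : Op1 →ₗ[ℂ] Op1) {n L : ℕ} {X : Type*} [MeasurableSpace X] (𝒟 : Measure X)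
  [IsProbabilityMeasure 𝒟] {G : X → Gates n L}

theorem integrable_fidelityKernel (hG : Measurable G) (ρ₀ : Op n) :
    Integrable (fun z : X × X => fidelityKernel N G ρ₀ z.1 z.2) (𝒟.prod 𝒟) := by
  have hc : Continuous fun z : Gates n L × Gates n L =>
      (circuit N z.1 ρ₀ * circuit N z.2 ρ₀).trace.re :=
    Complex.continuous_re.comp (((continuous_circuit N ρ₀).comp continuous_fst).matrix_mul
      ((continuous_circuit N ρ₀).comp continuous_snd)).matrix_trace
  have hm : Measurable (Prod.map G G) := hG.prodMap hG
  -- The data space has no topology, so integrability is proved for the pushforward to the compact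
  -- space of gates and pulled back along the measurable map.
  have := Measure.isProbabilityMeasure_map hm.aemeasurable (μ := 𝒟.prod 𝒟)
  exact (hc.integrable_of_compactSpace (μ := (𝒟.prod 𝒟).map (Prod.map G G))).comp_measurable hm

theorem integral_fidelityKernel_le {N} {t D : EuclideanSpace ℝ (Fin 3)} (hN : IsChannel N)
    (hform : HasNormalForm N t D) (hL : 1 ≤ L) (hG : Measurable G) (hP : IsCircuitLaw (𝒟.map G))
    {ρ₀ : Op n} (hρ : IsState ρ₀) :
    ∫ z : X × X, fidelityKernel N G ρ₀ z.1 z.2 ∂(𝒟.prod 𝒟)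
      ≤ ((1 + ‖t‖ ^ 2 + ‖D‖ ^ 2) / 2) ^ n := by
  have := hP.isProbabilityMeasure
  have hpc := continuous_purity_circuit N (L := L) ρ₀
  have hpi : Integrable (fun x => purity (circuit N (G x) ρ₀)) 𝒟 :=
    (hpc.integrable_of_compactSpace (μ := 𝒟.map G)).comp_measurable hG
  have hle := (hP.integral_purity_bounds hN hform hL hρ).2
  rw [integral_map hG.aemeasurable hpc.aestronglyMeasurable] at hle
  have hi₁ : Integrable (fun z : X × X => purity (circuit N (G z.1) ρ₀)) (𝒟.prod 𝒟) :=
    hpi.comp_fst 𝒟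
  have hi₂ : Integrable (fun z : X × X => purity (circuit N (G z.2) ρ₀)) (𝒟.prod 𝒟) :=
    hpi.comp_snd 𝒟
  calc ∫ z : X × X, fidelityKernel N G ρ₀ z.1 z.2 ∂(𝒟.prod 𝒟)
      ≤ ∫ z : X × X, (purity (circuit N (G z.1) ρ₀) + purity (circuit N (G z.2) ρ₀)) / 2
          ∂(𝒟.prod 𝒟) :=
        integral_mono (integrable_fidelityKernel N 𝒟 hG ρ₀) ((hi₁.add hi₂).div_const 2) fun z =>
          trace_mul_re_le (hρ.circuit hN _).1.isHermitian (hρ.circuit hN _).1.isHermitian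
    _ = ∫ x, purity (circuit N (G x) ρ₀) ∂𝒟 := by
        rw [integral_div, integral_add hi₁ hi₂,
          integral_fun_fst (fun x => purity (circuit N (G x) ρ₀)),
          integral_fun_snd (fun x => purity (circuit N (G x) ρ₀))]
        simp
    _ ≤ _ := hle

end Fidelity

end NoisyCircuit

end

/-! ### Assembly of the three statements. -/

theorem mainTheorem9 (N : NoisyCircuit.Op1 →ₗ[ℂ] NoisyCircuit.Op1)
    (t D : EuclideanSpace ℝ (Fin 3)) (hN : NoisyCircuit.IsChannel N)
    (hform : NoisyCircuit.HasNormalForm N t D) :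
    -- average purity of the output state and of its reduced states
    (∀ (n L : ℕ), 1 ≤ L → ∀ P : MeasureTheory.Measure (NoisyCircuit.Gates n L),
      NoisyCircuit.IsCircuitLaw P → ∀ ρ : NoisyCircuit.Op n, NoisyCircuit.IsState ρ →
        (((1 + ‖t‖ ^ 2) / 2) ^ n ≤ ∫ g, NoisyCircuit.purity (NoisyCircuit.circuit N g ρ) ∂P ∧
          ∫ g, NoisyCircuit.purity (NoisyCircuit.circuit N g ρ) ∂P
            ≤ ((1 + ‖t‖ ^ 2 + ‖D‖ ^ 2) / 2) ^ n) ∧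
        ∀ S : Finset (Fin n),
          ((1 + ‖t‖ ^ 2) / 2) ^ S.card
            ≤ ∫ g, NoisyCircuit.purity
                (NoisyCircuit.reduced S (NoisyCircuit.circuit N g ρ)) ∂P ∧
          ∫ g, NoisyCircuit.purity (NoisyCircuit.reduced S (NoisyCircuit.circuit N g ρ)) ∂P
            ≤ ((1 + ‖t‖ ^ 2 + ‖D‖ ^ 2) / 2) ^ S.card) ∧
    -- average fidelity kernel
    (∀ (n L : ℕ), 1 ≤ L → ∀ (X : Type u) [MeasurableSpace X] (𝒟 : MeasureTheory.Measure X)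
      [MeasureTheory.IsProbabilityMeasure 𝒟] (G : X → NoisyCircuit.Gates n L), Measurable G →
      NoisyCircuit.IsCircuitLaw (𝒟.map G) →
      ∀ ρ₀ : NoisyCircuit.Op n, NoisyCircuit.IsState ρ₀ →
        MeasureTheory.Integrable (fun z : X × X => NoisyCircuit.fidelityKernel N G ρ₀ z.1 z.2)
          (𝒟.prod 𝒟) ∧
        ∫ z : X × X, NoisyCircuit.fidelityKernel N G ρ₀ z.1 z.2 ∂(𝒟.prod 𝒟)
          ≤ ((1 + ‖t‖ ^ 2 + ‖D‖ ^ 2) / 2) ^ n) ∧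
    -- exponential smallness, with a rate that does not depend on `n`, `L` or the circuit
    (‖t‖ ^ 2 + ‖D‖ ^ 2 < 1 → ∃ c : ℝ, 0 < c ∧
      ∀ (n L : ℕ), 1 ≤ L → ∀ (X : Type u) [MeasurableSpace X] (𝒟 : MeasureTheory.Measure X)
        [MeasureTheory.IsProbabilityMeasure 𝒟] (G : X → NoisyCircuit.Gates n L), Measurable G →
        NoisyCircuit.IsCircuitLaw (𝒟.map G) →
        ∀ ρ₀ : NoisyCircuit.Op n, NoisyCircuit.IsState ρ₀ →
          ∫ z : X × X, NoisyCircuit.fidelityKernel N G ρ₀ z.1 z.2 ∂(𝒟.prod 𝒟)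
            ≤ Real.exp (-c * n)) := by
  refine ⟨fun n L hL P hP ρ hρ => ⟨hP.integral_purity_bounds hN hform hL hρ,
    hP.integral_purity_reduced_bounds hN hform hL hρ⟩, ?_, ?_⟩
  · intro n L hL X _ 𝒟 _ G hG hP ρ₀ hρ
    exact ⟨NoisyCircuit.integrable_fidelityKernel N 𝒟 hG ρ₀,
      NoisyCircuit.integral_fidelityKernel_le 𝒟 hN hform hL hG hP hρ⟩
  · intro hlt
    have hpos : 0 < (1 + ‖t‖ ^ 2 + ‖D‖ ^ 2) / 2 := by positivity
    -- The rate is minus the logarithm of the base of the kernel bound, which lies strictly between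
    -- 0 and 1, so e^{-cn} is exactly that bound.
    refine ⟨-Real.log ((1 + ‖t‖ ^ 2 + ‖D‖ ^ 2) / 2),
      neg_pos.mpr (Real.log_neg hpos (by linarith)), ?_⟩
    intro n L hL X _ 𝒟 _ G hG hP ρ₀ hρ
    refine (NoisyCircuit.integral_fidelityKernel_le 𝒟 hN hform hL hG hP hρ).trans_eq ?_
    rw [neg_neg, mul_comm, Real.exp_nat_mul, Real.exp_log hpos]
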